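/- Let $n,m\ge 1$, let $\mathbf C\subset\mathbb R^n$ be closed with compact boundary, let $\mathbf C^c$ be its complement, and write $d(x)$ for the Euclidean distance from $x$ to $\mathbf C$. Let $A\subset\mathbb R^m$ be compact, and let $l:\mathbf C^c\times A\to[0,+\infty)$ and $f:\mathbf C^c\times A\to\mathbb R^n$ be continuous. An *admissible pair* from $x\in\mathbf C^c$ consists of some $T_z\in(0,+\infty]$, a Borel measurable $\alpha:[0,T_z)\to A$, and a Carathéodory solution $z:[0,T_z)\to\mathbf C^c$ of $\dot z=f(z,\alpha)$, $z(0)=x$, such that $d(z(t))\to0$ as $t\to T_z^-$. The value function is $$\mathcal V(x)=\inf\int_0^{T_z} l(z(t),\alpha(t))\,dt\in[0,+\infty],$$ the infimum being over all admissible pairs from $x$ (with $\inf\emptyset=+\infty$). Put $H(x,p_0,p)=\inf_{a\in A}\big(p_0\,l(x,a)+\langle p,f(x,a)\rangle\big)$. A continuous function $U:\overline{\mathbf C^c}\to\mathbb R$ is a *Minimum Restraint Function with constant* $\bar p_0\ge0$ if - $U>0$ on $\mathbf C^c$ and $U=0$ on $\partial\mathbf C$ (positive definiteness); - $U^{-1}(K)$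 is compact for every compact $K\subset[0,+\infty)$ (properness); - $U$ is locally semiconcave on $\mathbf C^c$: each $x\in\mathbf C^c$ has a ball $B(x,\rho)\subset\mathbf C^c$ and a constant $R>0$ with $U(z_1)+U(z_2)-2U\big(\tfrac{z_1+z_2}{2}\big)\le R|z_1-z_2|^2$ for all $z_1,z_2\in B(x,\rho)$; - $H(x,\bar p_0,p)<0$ for every $x\in\mathbf C^c$ and every $p\in D^*U(x)$, where $D^*U(x)$ is the set of all limits $\lim_k\nabla U(x_k)$ along sequences $x_k\to x$ of points $x_k\ne x$ of $\mathbf C^c$ at which $U$ is differentiable. It is a *Minimum Restraint Function* if this holds for some $\bar p_0\ge0$. **Theorem.** (i) If a Minimum Restraint Function exists, then the system is globally asymptotically controllable to $\mathbf C$. That is, there is a function $\beta\in\mathcal{KL}$ such that from every $x\in\mathbf C^c$ there is an admissible pair $(z,\alpha)$ which, when $z$ is prolonged (in case $T_z<+\infty$) by $z(t)=\bar z$ for $t\ge T_z$ with some $\bar z\in\partial\mathbf C$, satisfies $$d(z(t))\le\beta(d(x),t)\qquad\forall\,t\ge0.$$ Here $\beta\in\mathcal{KL}$ means that $\beta:[0,+\infty)^2\to[0,+\infty)$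 is continuous; for every $t\ge0$, $\beta(0,t)=0$ and $\beta(\cdot,t)$ is strictly increasing and unbounded; and for every $r\ge0$, $\beta(r,\cdot)$ is nonincreasing with $\beta(r,t)\to0$ as $t\to+\infty$. (ii) If $U$ is a Minimum Restraint Function with constant $\bar p_0>0$, then $$\mathcal V(x)\le\frac{U(x)}{\bar p_0}\qquad\forall\,x\in\mathbf C^c.$$ -/

import Mathlib

open Set Filter Topology MeasureTheory

noncomputable section

namespace MinimumRestraint

/-- The state space `ℝⁿ` with the Euclidean norm. -/
abbrev E (n : ℕ) : Type := EuclideanSpace ℝ (Fin n)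

/-! ### Functions on the closure of the complement of the target -/

/-- Positive definiteness on the complement of `C`: positive there, zero on the boundary of `C`. -/
def PosDefOn {n : ℕ} (C : Set (E n)) (U : E n → ℝ) : Prop :=
  (∀ x ∈ Cᶜ, 0 < U x) ∧ ∀ x ∈ frontier C, U x = 0

/-- Properness of `U`, regarded as a function on the closure of the complement of `C`:
preimages of compact subsets of `[0, ∞)` are compact. -/
def ProperOn {n : ℕ} (C : Set (E n)) (U : E n → ℝ) : Prop :=
  ∀ K : Set ℝ, K ⊆ Ici 0 → IsCompact K → IsCompact (closure Cᶜ ∩ U ⁻¹' K)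

/-- Local semiconcavity of a continuous function on an open set `Ω`. -/
def LocallySemiconcaveOn {n : ℕ} (Ω : Set (E n)) (F : E n → ℝ) : Prop :=
  ContinuousOn F Ω ∧ ∀ x ∈ Ω, ∃ R > (0 : ℝ), ∃ ρ > (0 : ℝ), Metric.ball x ρ ⊆ Ω ∧
    ∀ z₁ ∈ Metric.ball x ρ, ∀ z₂ ∈ Metric.ball x ρ,
      F z₁ + F z₂ - 2 * F ((2 : ℝ)⁻¹ • (z₁ + z₂)) ≤ R * ‖z₁ - z₂‖ ^ 2

/-- The set `D^*F(x)` of limiting gradients at `x` of a function `F` on the open set `Ω`. -/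
def limitingGradient {n : ℕ} (Ω : Set (E n)) (F : E n → ℝ) (x : E n) : Set (E n) :=
  {w | ∃ y : ℕ → E n, (∀ k, y k ∈ Ω ∧ y k ≠ x ∧ DifferentiableAt ℝ F (y k)) ∧
    Tendsto y atTop (𝓝 x) ∧ Tendsto (fun k => gradient F (y k)) atTop (𝓝 w)}

/-- The minimized Hamiltonian `H(x, p₀, p) = inf_{a ∈ A} (p₀ l(x, a) + ⟨p, f(x, a)⟩)`. For
`x` outside the target the infimum is over a bounded below set, since `A` is compact and
`l`, `f` are continuous. -/
def hamiltonian {n m : ℕ} (A : Set (E m)) (f : E n → E m → E n) (l : E n → E m → ℝ)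
    (x : E n) (p₀ : ℝ) (p : E n) : ℝ :=
  sInf ((fun a => p₀ * l x a + inner ℝ p (f x a)) '' A)

/-- `U` is a Minimum Restraint Function with the constant `p₀ ≥ 0`. Only the values of `U` on the
closure of the complement of `C` matter. -/
structure IsMRFWith {n m : ℕ} (C : Set (E n)) (A : Set (E m)) (f : E n → E m → E n)
    (l : E n → E m → ℝ) (U : E n → ℝ) (p₀ : ℝ) : Prop where
  continuousOn : ContinuousOn U (closure Cᶜ)
  locallySemiconcaveOn : LocallySemiconcaveOn Cᶜ U
  posDefOn : PosDefOn C U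
  properOn : ProperOn C U
  nonneg : 0 ≤ p₀
  hamiltonian_neg : ∀ x ∈ Cᶜ, ∀ p ∈ limitingGradient Cᶜ U x, hamiltonian A f l x p₀ p < 0

/-- `U` is a Minimum Restraint Function. -/
def IsMRF {n m : ℕ} (C : Set (E n)) (A : Set (E m)) (f : E n → E m → E n)
    (l : E n → E m → ℝ) (U : E n → ℝ) : Prop :=
  ∃ p₀ : ℝ, IsMRFWith C A f l U p₀

/-! ### Trajectories, value function, asymptotic controllability -/

/-- The interval `[0, T)` of real numbers, where `T` may be `+∞`. -/
def timeInterval (T : EReal) : Set ℝ := {t | 0 ≤ t ∧ (t : EReal) < T}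

/-- `(z, α)` is an admissible trajectory-control pair on `[0, T)` with initial state `x`:
`α` is Borel measurable with values in `A`, `z` stays outside `C` and is a Carathéodory solution
of `ż = f(z, α)`, `z(0) = x` (in integral form: `z` is the indefinite integral of the locally
integrable function `f(z, α)`), and `d(z(t), C) → 0` as `t → T⁻`. The filter of real `t → T⁻` is
pulled back from the extended reals, in order to include `T = +∞`. Values of `z` and `α` outside
`[0, T)` play no role. -/
structure IsAdmissible {n m : ℕ} (C : Set (E n)) (A : Set (E m)) (f : E n → E m → E n)
    (x : E n) (T : EReal) (z : ℝ → E n) (α : ℝ → E m) : Prop where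
  pos : 0 < T
  measurable : Measurable α
  control_mem : ∀ t ∈ timeInterval T, α t ∈ A
  state_mem : ∀ t ∈ timeInterval T, z t ∈ Cᶜ
  integrable : ∀ t ∈ timeInterval T,
    IntervalIntegrable (fun s => f (z s) (α s)) volume 0 t
  solution : ∀ t ∈ timeInterval T, z t = x + ∫ s in (0 : ℝ)..t, f (z s) (α s)
  tendsto_target : Tendsto (fun t : ℝ => Metric.infDist (z t) C)
    (comap (fun t : ℝ => (t : EReal)) (𝓝[<] T)) (𝓝 0)

/-- The cost `∫₀ᵀ l(z(t), α(t)) dt`, possibly infinite, of a pair on `[0, T)`. -/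
def cost {n m : ℕ} (l : E n → E m → ℝ) (T : EReal) (z : ℝ → E n) (α : ℝ → E m) : ENNReal :=
  ∫⁻ t in timeInterval T, ENNReal.ofReal (l (z t) (α t))

/-- The value function: the infimum of the costs of all admissible pairs from `x`
(`+∞` if there is none). -/
def valueFunction {n m : ℕ} (C : Set (E n)) (A : Set (E m)) (f : E n → E m → E n)
    (l : E n → E m → ℝ) (x : E n) : ENNReal :=
  sInf {c | ∃ (T : EReal) (z : ℝ → E n) (α : ℝ → E m),
    IsAdmissible C A f x T z α ∧ c = cost l T z α}

/-- The class `𝓚𝓛` of comparison functions `[0, ∞) × [0, ∞) → [0, ∞)`. -/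
structure IsKL (β : ℝ → ℝ → ℝ) : Prop where
  continuousOn : ContinuousOn (fun q : ℝ × ℝ => β q.1 q.2) (Ici 0 ×ˢ Ici 0)
  nonneg : ∀ r, 0 ≤ r → ∀ t, 0 ≤ t → 0 ≤ β r t
  zero : ∀ t, 0 ≤ t → β 0 t = 0
  strictMonoOn : ∀ t, 0 ≤ t → StrictMonoOn (fun r => β r t) (Ici 0)
  unbounded : ∀ t, 0 ≤ t → ¬ BddAbove ((fun r => β r t) '' Ici 0)
  antitoneOn : ∀ r, 0 ≤ r → AntitoneOn (fun t => β r t) (Ici 0)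
  tendsto_zero : ∀ r, 0 ≤ r → Tendsto (fun t => β r t) atTop (𝓝 0)

/-- Global asymptotic controllability to `C`. From each initial state outside `C` there is an
admissible pair, defined on `[0, T)`, whose trajectory, prolonged by a constant point of the
boundary of `C` on `[T, ∞)` when `T < ∞`, satisfies the `𝓚𝓛` bound for all times. -/
def IsGAC {n m : ℕ} (C : Set (E n)) (A : Set (E m)) (f : E n → E m → E n) : Prop :=
  ∃ β : ℝ → ℝ → ℝ, IsKL β ∧ ∀ x ∈ Cᶜ, ∃ (T : EReal) (z : ℝ → E n) (α : ℝ → E m),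
    IsAdmissible C A f x T z α ∧
    (∃ zbar ∈ frontier C, ∀ t : ℝ, T ≤ (t : EReal) → z t = zbar) ∧
    ∀ t : ℝ, 0 ≤ t → Metric.infDist (z t) C ≤ β (Metric.infDist x C) t

end MinimumRestraint

end

/-! `U` is a control Lyapunov function for the dynamics augmented by the running cost. Semiconcavity
places `U`, at each point, below a paraboloid whose slope is a limit of nearby gradients. The
Hamiltonian is strictly negative at limiting gradients; compactness of the gradients and of `A`
spreads this to a neighbourhood, where each point has such a slope `p` and a control with `p₀ l +
⟨p, f⟩ ≤ -c`, with one `c` (`exists_uniform_descent_direction`). Freezing that control and solving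
the equation by Peano's theorem for a short time `s` makes `U` plus `p₀` times the cost fall at rate
at least `s` (`exists_hasDescentStep_nhds`). The lengths `s` can be kept away from zero on compact
subsets of `Cᶜ` (`exists_stepLength`).

Infinitely many such steps are concatenated (`exists_descent_trajectory`). For `a > 0` the band `a ≤
U ≤ b` is a compact subset of `Cᶜ`, so the steps starting in it have length at least some `s`, and
`U` falls below `a` within time about `b / s`, whatever the initial point with `U ≤ b`. Hence `U`,
and with it the distance to `C`, tends to zero. Summing the decreases bounds `p₀` times the cost by
`U x`, which is (ii).

For (i), properness of `U` and compactness of the boundary convert bounds and smallness of `U` into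
those of the distance and back. The selected trajectories are therefore uniformly bounded, stable
and attractive, and `exists_isKL` turns these three properties into one `𝓚𝓛` bound. -/

namespace MinimumRestraint

/-! ### Semiconcave functions and their supporting paraboloids -/

section Semiconcave

variable {V : Type*} [NormedAddCommGroup V]

/-- On a segment, subtract the chord and take a minimum point `t₀` of the difference `ψ`. Reflecting
the nearer endpoint through `t₀` gives `2 ψ(t₀) ≥ 0 + ψ(t₀)`, since `ψ` vanishes at the endpoints;
so the minimum is nonnegative. -/
theorem concaveOn_of_continuousOn_of_midpoint [NormedSpace ℝ V] {s : Set V} {G : V → ℝ}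
    (hs : Convex ℝ s) (hc : ContinuousOn G s)
    (h : ∀ x ∈ s, ∀ y ∈ s, G x + G y ≤ 2 * G ((2 : ℝ)⁻¹ • (x + y))) : ConcaveOn ℝ s G := by
  refine ⟨hs, fun x hx y hy a b ha hb hab => ?_⟩
  set γ : ℝ → V := fun t => AffineMap.lineMap x y t with hγ
  set ψ : ℝ → ℝ := fun t => G (γ t) - (1 - t) * G x - t * G y with hψ
  have hγs : ∀ t ∈ Icc (0 : ℝ) 1, γ t ∈ s := fun t ht => hs.lineMap_mem hx hy ht
  have hγc : Continuous γ := AffineMap.lineMap_continuous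
  have hψc : ContinuousOn ψ (Icc 0 1) := by
    have : ContinuousOn (fun t => G (γ t)) (Icc 0 1) := hc.comp hγc.continuousOn hγs
    exact (this.sub (by fun_prop)).sub (by fun_prop)
  have hmid : ∀ t h, t - h ∈ Icc (0 : ℝ) 1 → t + h ∈ Icc (0 : ℝ) 1 →
      ψ (t - h) + ψ (t + h) ≤ 2 * ψ t := by
    intro t k h1 h2
    have := h _ (hγs _ h1) _ (hγs _ h2)
    have he : (2 : ℝ)⁻¹ • (γ (t - k) + γ (t + k)) = γ t := by
      simp only [hγ, AffineMap.lineMap_apply_module]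
      module
    rw [he] at this
    simp only [hψ]
    linarith
  obtain ⟨t₀, ht₀, hmin⟩ := isCompact_Icc.exists_isMinOn (nonempty_Icc.2 zero_le_one) hψc
  have h0 : ψ 0 = 0 := by simp [hψ, hγ]
  have h1 : ψ 1 = 0 := by simp [hψ, hγ]
  have hpos : 0 ≤ ψ t₀ := by
    rcases le_total t₀ (1 / 2) with hle | hle
    · have m1 : t₀ - t₀ ∈ Icc (0 : ℝ) 1 := by simp
      have m2 : t₀ + t₀ ∈ Icc (0 : ℝ) 1 := ⟨by linarith [ht₀.1], by linarith⟩
      have e := hmid t₀ t₀ m1 m2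
      have := isMinOn_iff.1 hmin _ m2
      rw [sub_self, h0] at e
      linarith
    · have m1 : t₀ - (1 - t₀) ∈ Icc (0 : ℝ) 1 := ⟨by linarith, by linarith [ht₀.2]⟩
      have m2 : t₀ + (1 - t₀) ∈ Icc (0 : ℝ) 1 := by simp
      have e := hmid t₀ (1 - t₀) m1 m2
      have := isMinOn_iff.1 hmin _ m1
      rw [add_sub_cancel, h1] at e
      linarith
  have hb1 : b ∈ Icc (0 : ℝ) 1 := ⟨hb, by linarith⟩
  have := hpos.trans (isMinOn_iff.1 hmin b hb1)
  have hab' : a = 1 - b := by linarith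
  have he : γ b = a • x + b • y := by simp [hγ, AffineMap.lineMap_apply_module, hab']
  simp only [hψ, he] at this
  simp only [smul_eq_mul]
  subst hab'
  linarith

variable [InnerProductSpace ℝ V]

/-- By the parallelogram law the midpoint defect of `‖· - c‖ ^ 2` is `‖x - y‖ ^ 2 / 2`, so the
coefficient `2 R` exactly absorbs the semiconcavity defect, for every centre `c`. -/
theorem concaveOn_sub_sq_of_semiconcave {s : Set V} {F : V → ℝ} {R : ℝ} (hs : Convex ℝ s)
    (hc : ContinuousOn F s)
    (h : ∀ x ∈ s, ∀ y ∈ s, F x + F y - 2 * F ((2 : ℝ)⁻¹ • (x + y)) ≤ R * ‖x - y‖ ^ 2) (c : V) :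
    ConcaveOn ℝ s (fun y => F y - 2 * R * ‖y - c‖ ^ 2) := by
  refine concaveOn_of_continuousOn_of_midpoint hs (hc.sub (by fun_prop)) fun x hx y hy => ?_
  have h1 := h x hx y hy
  have h2 := parallelogram_law_with_norm ℝ (x - c) (y - c)
  have h3 : ‖(2 : ℝ)⁻¹ • (x + y) - c‖ ^ 2 = 4⁻¹ * ‖(x - c) + (y - c)‖ ^ 2 := by
    have : (2 : ℝ)⁻¹ • (x + y) - c = (2 : ℝ)⁻¹ • ((x - c) + (y - c)) := by module
    rw [this, norm_smul, mul_pow]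
    norm_num
  have h4 : (x - c) - (y - c) = x - y := by abel
  rw [h4] at h2
  have h5 := congrArg (R * ·) h2
  simp only [mul_add] at h5
  simp only [h3]
  linarith

/-- Centring the subtracted paraboloid at `x` leaves the gradient at `x` unchanged, and a concave
function lies below its tangent: its difference quotients along the segment to `y` dominate the full
increment, and `t → 0⁺` yields the gradient. -/
theorem le_gradient_of_semiconcave [CompleteSpace V] {s : Set V} {F : V → ℝ} {R : ℝ}
    (hs : Convex ℝ s) (hc : ContinuousOn F s)
    (h : ∀ x ∈ s, ∀ y ∈ s, F x + F y - 2 * F ((2 : ℝ)⁻¹ • (x + y)) ≤ R * ‖x - y‖ ^ 2)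
    {x y : V} (hx : x ∈ s) (hy : y ∈ s) (hd : DifferentiableAt ℝ F x) :
    F y ≤ F x + inner ℝ (gradient F x) (y - x) + 2 * R * ‖y - x‖ ^ 2 := by
  have hG := concaveOn_sub_sq_of_semiconcave hs hc h x
  have hline : Tendsto (fun t : ℝ => t⁻¹ • (F (x + t • (y - x)) - F x)) (𝓝[>] 0)
      (𝓝 (inner ℝ (gradient F x) (y - x))) := by
    have := (hd.hasGradientAt.hasFDerivAt.hasLineDerivAt (y - x)).tendsto_slope_zero_right
    simpa using this
  have hq : Tendsto (fun t : ℝ => t⁻¹ • (F (x + t • (y - x)) - F x) - 2 * R * ‖y - x‖ ^ 2 * t)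
      (𝓝[>] 0) (𝓝 (inner ℝ (gradient F x) (y - x) - 2 * R * ‖y - x‖ ^ 2 * 0)) :=
    hline.sub (((continuous_const.mul continuous_id).tendsto _).mono_left nhdsWithin_le_nhds)
  have key : ∀ᶠ t : ℝ in 𝓝[>] 0, F y - F x - 2 * R * ‖y - x‖ ^ 2 ≤
      t⁻¹ • (F (x + t • (y - x)) - F x) - 2 * R * ‖y - x‖ ^ 2 * t := by
    filter_upwards [Ioo_mem_nhdsGT (zero_lt_one' ℝ)] with t ht
    have := hG.2 hx hy (sub_nonneg.2 ht.2.le) ht.1.le (sub_add_cancel 1 t)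
    have e1 : (1 - t) • x + t • y = x + t • (y - x) := by module
    have e2 : x + t • (y - x) - x = t • (y - x) := by abel
    rw [e1] at this
    simp only [e2, norm_smul, sub_self, norm_zero, smul_eq_mul, mul_pow, Real.norm_eq_abs,
      sq_abs] at this
    rw [smul_eq_mul, ← sub_nonneg]
    have hd : t⁻¹ * (F (x + t • (y - x)) - F x) - 2 * R * ‖y - x‖ ^ 2 * t -
        (F y - F x - 2 * R * ‖y - x‖ ^ 2) = t⁻¹ * ((F (x + t • (y - x)) - F x) -
        2 * R * ‖y - x‖ ^ 2 * t * t - t * (F y - F x - 2 * R * ‖y - x‖ ^ 2)) := by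
      field_simp [ht.1.ne']
    rw [hd]
    refine mul_nonneg (inv_nonneg.2 ht.1.le) ?_
    linarith
  have := ge_of_tendsto hq key
  linarith

end Semiconcave

/-! ### Peano's theorem by Tonelli's delayed equations -/

section Peano

variable {V : Type*} [NormedAddCommGroup V] [NormedSpace ℝ V]

/-- One step of Tonelli's scheme with delay `h` for `ż = g(z)`, `z(0) = x`. -/
noncomputable def tonelli (g : V → V) (x : V) (h : ℝ) (w : ℝ → V) (t : ℝ) : V :=
  x + ∫ s in (0 : ℝ)..max t 0, g (w (s - h))

theorem norm_tonelli_sub_le {g : V → V} {F : ℝ} (hF : ∀ y, ‖g y‖ ≤ F)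
    (hg : Continuous g) {x : V} {h : ℝ} {w : ℝ → V} (hw : Continuous w) (t s : ℝ) :
    ‖tonelli g x h w t - tonelli g x h w s‖ ≤ F * |t - s| := by
  have hc : Continuous fun s => g (w (s - h)) := by fun_prop
  have : tonelli g x h w t - tonelli g x h w s = ∫ r in max s 0..max t 0, g (w (r - h)) := by
    rw [← intervalIntegral.integral_interval_sub_left (hc.intervalIntegrable 0 _)
      (hc.intervalIntegrable 0 _)]
    simp [tonelli]
  rw [this]
  refine (intervalIntegral.norm_integral_le_of_norm_le_const fun r _ => hF _).trans ?_
  have hF0 : 0 ≤ F := (norm_nonneg _).trans (hF 0)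
  exact mul_le_mul_of_nonneg_left (abs_max_sub_max_le_abs _ _ _) hF0

/-- Approximate solutions: continuous curves solving the equation with a delay `h > 0`. -/
theorem exists_delayed_solution {g : V → V} {F : ℝ} (hF : ∀ y, ‖g y‖ ≤ F)
    (hg : Continuous g) (x : V) {h : ℝ} (hh : 0 < h) (T : ℝ) :
    ∃ w : ℝ → V, (∀ t s, ‖w t - w s‖ ≤ F * |t - s|) ∧ w 0 = x ∧
      ∀ t ∈ Icc 0 T, w t = x + ∫ s in (0 : ℝ)..t, g (w (s - h)) := by
  have hF0 : 0 ≤ F := (norm_nonneg _).trans (hF 0)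
  set w : ℕ → ℝ → V := fun k => (tonelli g x h)^[k] (fun _ => x) with hwdef
  have hsucc : ∀ k, w (k + 1) = tonelli g x h (w k) := fun k =>
    Function.iterate_succ_apply' _ _ _
  have hcont_of : ∀ u : ℝ → V, (∀ t s, ‖u t - u s‖ ≤ F * |t - s|) → Continuous u := by
    intro u hu
    refine (LipschitzWith.of_dist_le_mul (K := F.toNNReal) fun t s => ?_).continuous
    rw [dist_eq_norm, Real.dist_eq, Real.coe_toNNReal _ hF0]
    exact hu t s
  have hlip : ∀ k t s, ‖w k t - w k s‖ ≤ F * |t - s| := by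
    intro k
    induction k with
    | zero => intro t s; simp [hwdef]; positivity
    | succ k ih => rw [hsucc]; exact norm_tonelli_sub_le hF hg (hcont_of _ ih)
  -- The delay makes the value at `t` depend only on the past up to `t - h`, so each iteration
  -- settles one more interval of length `h`; finitely many iterations reach `T`.
  have hstab : ∀ k : ℕ, ∀ t : ℝ, t ≤ k * h → w (k + 1) t = w k t := by
    intro k
    induction k with
    | zero =>
      intro t ht
      rw [hsucc]
      simp only [tonelli, CharP.cast_eq_zero, zero_mul] at ht ⊢
      rw [max_eq_right ht]
      simp [hwdef]
    | succ k ih =>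
      intro t ht
      rw [hsucc (k + 1), hsucc k]
      simp only [tonelli]
      congr 1
      refine intervalIntegral.integral_congr fun s hs => ?_
      rw [uIcc_of_le (le_max_right _ _)] at hs
      have h1 : s ≤ (k + 1) * h := hs.2.trans (max_le (by exact_mod_cast ht) (by positivity))
      show g _ = g _
      have e := ih (s - h) (by linarith)
      rw [hsucc] at e
      exact congrArg g e
  obtain ⟨N, hN⟩ := exists_nat_ge (T / h)
  refine ⟨w N, hlip N, ?_, fun t ht => ?_⟩
  · rw [← hstab N 0 (by positivity), hsucc]
    simp [tonelli]
  · have hT : T ≤ N * h := by rwa [div_le_iff₀ hh] at hN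
    conv_lhs => rw [← hstab N t (ht.2.trans hT), hsucc]
    simp only [tonelli, max_eq_left ht.1]

/-- Let the delays `1 / (k + 1)` tend to zero. Tychonoff's theorem and an ultrafilter give a
pointwise limit; the common Lipschitz constant `F` makes the delayed integrands converge locally
uniformly, so the integral equation passes to the limit. -/
theorem exists_solution_of_bounded_continuous [FiniteDimensional ℝ V] {g : V → V} {F : ℝ} (hF : ∀ y, ‖g y‖ ≤ F)
    (hg : Continuous g) (x : V) (T : ℝ) :
    ∃ z : ℝ → V, Continuous z ∧ (∀ t, 0 ≤ t → ‖z t - x‖ ≤ F * t) ∧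
      ∀ t ∈ Icc 0 T, z t = x + ∫ s in (0 : ℝ)..t, g (z s) := by
  have hF0 : 0 ≤ F := (norm_nonneg _).trans (hF 0)
  have hh : ∀ k : ℕ, (0 : ℝ) < 1 / (k + 1) := fun k => Nat.one_div_pos_of_nat
  choose w hlip h0 hsol using fun k : ℕ => exists_delayed_solution hF hg x (hh k) T
  have hproper : ProperSpace V := FiniteDimensional.proper ℝ V
  let S : Set (ℝ → V) := Set.pi univ fun t => Metric.closedBall x (F * |t|)
  have hS : IsCompact S := isCompact_univ_pi fun t => isCompact_closedBall _ _
  obtain ⟨u, hu⟩ : ∃ u : Ultrafilter ℕ, (u : Filter ℕ) ≤ atTop := Ultrafilter.exists_le atTop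
  have hwS : ∀ k, w k ∈ S := fun k t _ => by
    have := hlip k t 0
    rw [h0, sub_zero] at this
    simpa [dist_eq_norm] using this
  obtain ⟨z, -, hz⟩ := hS.ultrafilter_le_nhds (u.map w)
    (le_principal_iff.2 (Eventually.of_forall (f := (u : Filter ℕ)) hwS))
  have hz' : ∀ t, Tendsto (fun k => w k t) u (𝓝 (z t)) := by
    have : Tendsto w u (𝓝 z) := hz
    exact tendsto_pi_nhds.1 this
  have hzlip : ∀ t s, ‖z t - z s‖ ≤ F * |t - s| := fun t s =>
    le_of_tendsto ((hz' t).sub (hz' s)).norm (Eventually.of_forall fun k => hlip k t s)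
  have hz0 : z 0 = x := tendsto_nhds_unique (hz' 0) (by simp [h0])
  have hlipK : LipschitzWith F.toNNReal z := LipschitzWith.of_dist_le_mul fun t s => by
    rw [dist_eq_norm, Real.dist_eq, Real.coe_toNNReal _ hF0]; exact hzlip t s
  refine ⟨z, hlipK.continuous, fun t ht => ?_, fun t ht => ?_⟩
  · simpa [hz0, abs_of_nonneg ht] using hzlip t 0
  have hdelay : Tendsto (fun k : ℕ => F * (1 / ((k : ℝ) + 1))) u (𝓝 0) := by
    simpa using (tendsto_one_div_add_atTop_nhds_zero_nat.const_mul F).mono_left hu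
  have hunif : TendstoLocallyUniformlyOn (fun k s => g (w k (s - 1 / (k + 1)))) (fun s => g (z s))
      u (uIcc 0 t) := by
    rw [Metric.tendstoLocallyUniformlyOn_iff]
    intro ε hε s₀ _
    obtain ⟨δ, hδ, hgδ⟩ := Metric.continuous_iff.1 hg (z s₀) (ε / 2) (by positivity)
    refine ⟨Metric.ball s₀ (δ / (3 * (F + 1))),
      mem_nhdsWithin_of_mem_nhds (Metric.ball_mem_nhds _ (by positivity)), ?_⟩
    filter_upwards [hdelay.eventually (gt_mem_nhds (show 0 < δ / 3 by positivity)),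
      (Metric.tendsto_nhds.1 (hz' s₀)) (δ / 3) (by positivity)] with k hk1 hk2 s hs
    have hs' : F * |s - s₀| < δ / 3 := by
      rw [Metric.mem_ball, Real.dist_eq, lt_div_iff₀ (by positivity)] at hs
      nlinarith [abs_nonneg (s - s₀)]
    have e1 : dist (z s) (z s₀) < δ := by
      rw [dist_eq_norm]
      linarith [hzlip s s₀]
    have e2 : dist (w k (s - 1 / (k + 1))) (z s₀) < δ := by
      have a1 := hlip k (s - 1 / (k + 1)) s
      have a2 := hlip k s s₀
      have a3 : |s - 1 / ((k : ℝ) + 1) - s| = 1 / ((k : ℝ) + 1) := by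
        rw [sub_sub_cancel_left, abs_neg, abs_of_pos (hh k)]
      rw [a3, ← dist_eq_norm] at a1
      rw [← dist_eq_norm] at a2
      linarith [dist_triangle4 (w k (s - 1 / (k + 1))) (w k s) (w k s₀) (z s₀)]
    calc dist (g (z s)) (g (w k (s - 1 / (k + 1))))
        ≤ dist (g (z s)) (g (z s₀)) + dist (g (w k (s - 1 / (k + 1)))) (g (z s₀)) :=
          dist_triangle_right _ _ _
      _ < ε / 2 + ε / 2 := add_lt_add (hgδ _ e1) (hgδ _ e2)
      _ = ε := add_halves ε
  have hwc : ∀ k, Continuous (w k) := fun k =>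
    (LipschitzWith.of_dist_le_mul (K := F.toNNReal) fun t s => by
      rw [dist_eq_norm, Real.dist_eq, Real.coe_toNNReal _ hF0]; exact hlip k t s).continuous
  have hint : Tendsto (fun k => ∫ s in (0 : ℝ)..t, g (w k (s - 1 / (k + 1)))) u
      (𝓝 (∫ s in (0 : ℝ)..t, g (z s))) := by
    rw [Metric.tendsto_nhds]
    intro ε hε
    filter_upwards [Metric.tendstoUniformlyOn_iff.1
      ((tendstoLocallyUniformlyOn_iff_tendstoUniformlyOn_of_compact isCompact_uIcc).1 hunif)
      (ε / (|t| + 1)) (by positivity)] with k hk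
    have hc1 : Continuous fun s => g (w k (s - 1 / (k + 1))) :=
      hg.comp ((hwc k).comp (by fun_prop))
    have hc2 : Continuous fun s => g (z s) := hg.comp hlipK.continuous
    rw [dist_eq_norm, ← intervalIntegral.integral_sub (hc1.intervalIntegrable _ _)
      (hc2.intervalIntegrable _ _)]
    refine (intervalIntegral.norm_integral_le_of_norm_le_const fun s hs => ?_).trans_lt
      (?_ : ε / (|t| + 1) * |t - 0| < ε)
    · rw [← dist_eq_norm, dist_comm]
      exact (hk s (uIoc_subset_uIcc hs)).le
    · rw [sub_zero, div_mul_eq_mul_div, div_lt_iff₀ (by positivity)]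
      nlinarith [abs_nonneg t]
  refine tendsto_nhds_unique (hz' t) ((hint.const_add x).congr fun k => ?_)
  exact (hsol k t ht).symm

/-- **Peano's existence theorem**, for a vector field continuous on a closed ball. -/
theorem exists_solution_of_continuousOn_closedBall [FiniteDimensional ℝ V] {g : V → V}
    {x : V} {F r T : ℝ} (hF : ∀ y ∈ Metric.closedBall x r, ‖g y‖ ≤ F) (hF0 : 0 < F)
    (hg : ContinuousOn g (Metric.closedBall x r)) (hT : F * T ≤ r) :
    ∃ z : ℝ → V, Continuous z ∧ z 0 = x ∧ (∀ t ∈ Icc 0 T, ‖z t - x‖ ≤ F * t) ∧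
      ∀ t ∈ Icc 0 T, z t = x + ∫ s in (0 : ℝ)..t, g (z s) := by
  -- The Tietze extension keeps the bound `F`; as `F * T ≤ r`, its solution stays in the ball where
  -- it agrees with `g`.
  have hext := Metric.instTietzeExtensionClosedBall ℝ (0 : V) hF0
  obtain ⟨G, hGF, hG⟩ := ContinuousMap.exists_forall_mem_restrict_eq
    (t := Metric.closedBall (0 : V) F) (Metric.isClosed_closedBall (x := x) (ε := r))
    ⟨_, hg.domRestrict⟩ (fun y => by simpa using! hF y y.2)
  have hGg : ∀ y ∈ Metric.closedBall x r, G y = g y := fun y hy =>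
    congrFun (congrArg DFunLike.coe hG) ⟨y, hy⟩
  obtain ⟨z, hzc, hzx, hz⟩ := exists_solution_of_bounded_continuous (g := G) (F := F)
    (fun y => by simpa using hGF y) G.continuous x T
  refine ⟨z, hzc, by simpa [sub_eq_zero] using hzx 0 le_rfl, fun t ht => hzx t ht.1, fun t ht => ?_⟩
  rw [hz t ht]
  congr 1
  refine intervalIntegral.integral_congr fun s hs => hGg _ ?_
  rw [uIcc_of_le ht.1] at hs
  rw [mem_closedBall_iff_norm]
  exact (hzx s hs.1).trans ((mul_le_mul_of_nonneg_left (hs.2.trans ht.2) hF0.le).trans hT)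

end Peano

/-! ### Class `𝓚𝓛` majorants for families of curves -/

section KL

/-- The truncation of a real number to `[0, 1]`. -/
noncomputable def clamp (u : ℝ) : ℝ := max 0 (min 1 u)

theorem clamp_nonneg (u : ℝ) : 0 ≤ clamp u := le_max_left _ _

theorem clamp_le_one (u : ℝ) : clamp u ≤ 1 := max_le zero_le_one (min_le_left _ _)

theorem clamp_mono : Monotone clamp := fun _ _ h => max_le_max le_rfl (min_le_min le_rfl h)

theorem clamp_eq_one {u : ℝ} (h : 1 ≤ u) : clamp u = 1 := by simp [clamp, h]

theorem clamp_eq_zero {u : ℝ} (h : u ≤ 0) : clamp u = 0 := by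
  rw [clamp, min_eq_right (h.trans zero_le_one), max_eq_left h]

theorem clamp_le_add (u v : ℝ) : clamp u ≤ clamp v + |u - v| := by
  have h1 := neg_abs_le (u - v)
  have h2 := le_abs_self (u - v)
  simp only [clamp]
  rcases max_cases 0 (min 1 u) with h | h <;> rcases max_cases 0 (min 1 v) with h' | h' <;>
    rcases min_cases 1 u with h3 | h3 <;> rcases min_cases 1 v with h4 | h4 <;> linarith

theorem clamp_mul_clamp_le (u v u' v' : ℝ) :
    clamp u * clamp v ≤ clamp u' * clamp v' + (|u - u'| + |v - v'|) := by
  have h1 := clamp_le_add u u'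
  have h2 := clamp_le_add v v'
  nlinarith [clamp_nonneg u, clamp_nonneg v, clamp_nonneg u', clamp_nonneg v', clamp_le_one u,
    clamp_le_one v, clamp_le_one u', clamp_le_one v', abs_nonneg (u - u'), abs_nonneg (v - v')]

variable {ι : Type*} (s : ι → ℝ) (D : ι → ℝ → ℝ)

/-- The weighted value at time `q.2` of the curve with index `q.1`, with a weight which is one if
`s q.1 ≤ r` and `t ≤ q.2`, and vanishes unless `s q.1 ≤ 2 r` and `t - 1 ≤ q.2`. -/
noncomputable def weighted (r t : ℝ) (q : ι × Ici (0 : ℝ)) : ℝ :=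
  D q.1 q.2 * (clamp (2 - s q.1 * r⁻¹) * clamp (q.2 - t + 1))

open Classical in
/-- A continuous majorant of the curves `D i`, as a function of `s i` and the time. -/
noncomputable def envelope (r t : ℝ) : ℝ := if r ≤ 0 then 0 else ⨆ q, weighted s D r t q

variable {s D}

theorem weighted_nonneg (hD : ∀ i τ, 0 ≤ τ → 0 ≤ D i τ) (r t : ℝ) (q : ι × Ici (0 : ℝ)) :
    0 ≤ weighted s D r t q :=
  mul_nonneg (hD _ _ q.2.2) (mul_nonneg (clamp_nonneg _) (clamp_nonneg _))

theorem weighted_le (hD : ∀ i τ, 0 ≤ τ → 0 ≤ D i τ) {r t M : ℝ} (hr : 0 < r) (hM0 : 0 ≤ M)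
    (hM : ∀ i, s i ≤ 2 * r → ∀ τ, 0 ≤ τ → t - 1 ≤ τ → D i τ ≤ M) (q : ι × Ici (0 : ℝ)) :
    weighted s D r t q ≤ M := by
  rw [weighted]
  by_cases h : s q.1 ≤ 2 * r ∧ t - 1 ≤ q.2
  · calc _ ≤ D q.1 q.2 * 1 := mul_le_mul_of_nonneg_left
          (mul_le_one₀ (clamp_le_one _) (clamp_nonneg _) (clamp_le_one _)) (hD _ _ q.2.2)
      _ ≤ M := by rw [mul_one]; exact hM _ h.1 _ q.2.2 h.2
  · rw [not_and_or, not_le, not_le] at h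
    rcases h with h | h
    · have : 2 ≤ s q.1 * r⁻¹ := by rw [← div_eq_mul_inv, le_div_iff₀ hr]; exact h.le
      rw [clamp_eq_zero (by linarith : 2 - s q.1 * r⁻¹ ≤ 0)]
      simpa
    · rw [clamp_eq_zero (by linarith : (q.2 : ℝ) - t + 1 ≤ 0)]
      simpa

theorem envelope_nonneg (hD : ∀ i τ, 0 ≤ τ → 0 ≤ D i τ) (r t : ℝ) : 0 ≤ envelope s D r t := by
  rw [envelope]
  split_ifs
  · exact le_rfl
  · exact Real.iSup_nonneg fun q => weighted_nonneg hD r t q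

theorem envelope_le (hD : ∀ i τ, 0 ≤ τ → 0 ≤ D i τ) {r t M : ℝ} (hM0 : 0 ≤ M)
    (hM : ∀ i, s i ≤ 2 * r → ∀ τ, 0 ≤ τ → t - 1 ≤ τ → D i τ ≤ M) : envelope s D r t ≤ M := by
  rw [envelope]
  split_ifs with h
  · exact hM0
  · exact Real.iSup_le (weighted_le hD (not_le.1 h) hM0 hM) hM0

theorem bddAbove_weighted (hD : ∀ i τ, 0 ≤ τ → 0 ≤ D i τ)
    (hbdd : ∀ r, ∃ M, ∀ i, s i ≤ r → ∀ τ, 0 ≤ τ → D i τ ≤ M) {r : ℝ} (hr : 0 < r) (t : ℝ) :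
    BddAbove (range (weighted s D r t)) := by
  obtain ⟨M, hM⟩ := hbdd (2 * r)
  refine ⟨max M 0, ?_⟩
  rintro _ ⟨q, rfl⟩
  exact weighted_le hD hr (le_max_right _ _)
    (fun i hi τ hτ _ => (hM i hi τ hτ).trans (le_max_left _ _)) q

theorem envelope_mono_left (hs : ∀ i, 0 < s i) (hD : ∀ i τ, 0 ≤ τ → 0 ≤ D i τ)
    (hbdd : ∀ r, ∃ M, ∀ i, s i ≤ r → ∀ τ, 0 ≤ τ → D i τ ≤ M) (t : ℝ) :
    Monotone fun r => envelope s D r t := by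
  intro r r' h
  show envelope s D r t ≤ envelope s D r' t
  by_cases hr : r ≤ 0
  · have : envelope s D r t = 0 := if_pos hr
    rw [this]
    exact envelope_nonneg hD _ _
  · rw [not_le] at hr
    simp only [envelope, if_neg (not_le.2 hr), if_neg (not_le.2 (hr.trans_le h))]
    refine Real.iSup_le (fun q => le_ciSup_of_le (bddAbove_weighted hD hbdd (hr.trans_le h) t) q ?_)
      (Real.iSup_nonneg fun q => weighted_nonneg hD _ t q)
    refine mul_le_mul_of_nonneg_left (mul_le_mul_of_nonneg_right (clamp_mono ?_)
      (clamp_nonneg _)) (hD _ _ q.2.2)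
    have := mul_le_mul_of_nonneg_left (inv_anti₀ hr h) (hs q.1).le
    linarith

theorem envelope_anti_right (hD : ∀ i τ, 0 ≤ τ → 0 ≤ D i τ)
    (hbdd : ∀ r, ∃ M, ∀ i, s i ≤ r → ∀ τ, 0 ≤ τ → D i τ ≤ M) (r : ℝ) :
    Antitone fun t => envelope s D r t := by
  intro t t' h
  simp only [envelope]
  split_ifs with hr
  · exact le_rfl
  · refine Real.iSup_le (fun q => le_ciSup_of_le (bddAbove_weighted hD hbdd (not_le.1 hr) t) q ?_)
      (Real.iSup_nonneg fun q => weighted_nonneg hD _ t q)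
    exact mul_le_mul_of_nonneg_left (mul_le_mul_of_nonneg_left (clamp_mono (by linarith))
      (clamp_nonneg _)) (hD _ _ q.2.2)

theorem le_envelope (hs : ∀ i, 0 < s i) (hD : ∀ i τ, 0 ≤ τ → 0 ≤ D i τ)
    (hbdd : ∀ r, ∃ M, ∀ i, s i ≤ r → ∀ τ, 0 ≤ τ → D i τ ≤ M) (i : ι) {τ : ℝ} (hτ : 0 ≤ τ) :
    D i τ ≤ envelope s D (s i) τ := by
  rw [envelope, if_neg (not_le.2 (hs i))]
  refine le_ciSup_of_le (bddAbove_weighted hD hbdd (hs i) τ) (i, ⟨τ, hτ⟩) ?_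
  rw [weighted, mul_inv_cancel₀ (hs i).ne', clamp_eq_one (by norm_num), clamp_eq_one (by simp)]
  simp

/-- For `s i ≤ 2 b` the weights are Lipschitz in `r⁻¹` and `t` with constants independent of the
curve and of the time; for larger `s i` the weight at `r ≤ b` vanishes. The modulus therefore
survives the supremum. -/
theorem envelope_le_add (hs : ∀ i, 0 < s i) (hD : ∀ i τ, 0 ≤ τ → 0 ≤ D i τ)
    (hbdd : ∀ r, ∃ M, ∀ i, s i ≤ r → ∀ τ, 0 ≤ τ → D i τ ≤ M) {r r' t t' b M : ℝ} (hr : 0 < r)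
    (hr' : 0 < r') (hb : r ≤ b) (hM0 : 0 ≤ M)
    (hM : ∀ i, s i ≤ 2 * b → ∀ τ, 0 ≤ τ → D i τ ≤ M) :
    envelope s D r t ≤ envelope s D r' t' + M * (2 * b * |r⁻¹ - r'⁻¹| + |t - t'|) := by
  have hb0 : 0 < b := hr.trans_le hb
  have h0 : 0 ≤ M * (2 * b * |r⁻¹ - r'⁻¹| + |t - t'|) := by positivity
  have hpos := envelope_nonneg (s := s) hD r' t'
  simp only [envelope, if_neg (not_le.2 hr), if_neg (not_le.2 hr')] at hpos ⊢
  refine Real.iSup_le (fun q => ?_) (by positivity)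
  by_cases h : s q.1 ≤ 2 * b
  · refine le_trans ?_ (add_le_add_left (le_ciSup (bddAbove_weighted hD hbdd hr' t') q) _)
    have h1 := clamp_mul_clamp_le (2 - s q.1 * r⁻¹) (q.2 - t + 1) (2 - s q.1 * r'⁻¹) (q.2 - t' + 1)
    have h2 : |2 - s q.1 * r⁻¹ - (2 - s q.1 * r'⁻¹)| ≤ 2 * b * |r⁻¹ - r'⁻¹| := by
      have : 2 - s q.1 * r⁻¹ - (2 - s q.1 * r'⁻¹) = -(s q.1 * (r⁻¹ - r'⁻¹)) := by ring
      rw [this, abs_neg, abs_mul, abs_of_pos (hs _)]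
      exact mul_le_mul_of_nonneg_right h (abs_nonneg _)
    have h3 : |(q.2 : ℝ) - t + 1 - (q.2 - t' + 1)| = |t - t'| := by
      have : (q.2 : ℝ) - t + 1 - (q.2 - t' + 1) = -(t - t') := by ring
      rw [this, abs_neg]
    rw [h3] at h1
    have hDq := hD q.1 q.2 q.2.2
    have hMq := hM q.1 h q.2 q.2.2
    simp only [weighted]
    calc _ ≤ D q.1 q.2 * (clamp (2 - s q.1 * r'⁻¹) * clamp (q.2 - t' + 1) +
          (2 * b * |r⁻¹ - r'⁻¹| + |t - t'|)) := mul_le_mul_of_nonneg_left (by linarith) hDq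
      _ ≤ _ := by
        rw [mul_add]
        exact add_le_add le_rfl (mul_le_mul_of_nonneg_right hMq (by positivity))
  · have h2 : 2 ≤ s q.1 * r⁻¹ := by rw [← div_eq_mul_inv, le_div_iff₀ hr]; linarith
    have : weighted s D r t q = 0 := by
      rw [weighted, clamp_eq_zero (by linarith : 2 - s q.1 * r⁻¹ ≤ 0)]
      simp
    rw [this]
    positivity

/-- At `r = 0` continuity is exactly the stability hypothesis `hsmall`. At `r₀ > 0` it follows from
`envelope_le_add` used in both directions. -/
theorem continuousOn_envelope (hs : ∀ i, 0 < s i) (hD : ∀ i τ, 0 ≤ τ → 0 ≤ D i τ)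
    (hbdd : ∀ r, ∃ M, ∀ i, s i ≤ r → ∀ τ, 0 ≤ τ → D i τ ≤ M)
    (hsmall : ∀ ε > 0, ∃ r > 0, ∀ i, s i ≤ r → ∀ τ, 0 ≤ τ → D i τ ≤ ε) :
    ContinuousOn (fun q : ℝ × ℝ => envelope s D q.1 q.2) (Ici 0 ×ˢ Ici 0) := by
  rintro ⟨r₀, t₀⟩ ⟨hr₀, -⟩
  rw [mem_Ici] at hr₀
  refine ContinuousAt.continuousWithinAt ?_
  rcases hr₀.eq_or_lt with h | h
  · dsimp only at h
    subst h
    have h00 : envelope s D 0 t₀ = 0 := if_pos le_rfl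
    rw [ContinuousAt, h00, Metric.tendsto_nhds]
    intro ε hε
    obtain ⟨r, hr, hrε⟩ := hsmall (ε / 2) (by positivity)
    have : ∀ᶠ q : ℝ × ℝ in 𝓝 (0, t₀), q.1 < r / 2 :=
      continuous_fst.continuousAt.eventually (gt_mem_nhds (by simpa using hr))
    filter_upwards [this] with q hq
    rw [Real.dist_0_eq_abs, abs_of_nonneg (envelope_nonneg hD _ _)]
    refine (envelope_le hD (by positivity) fun i hi τ hτ _ => hrε i (by linarith) τ hτ).trans_lt
      (half_lt_self hε)
  · dsimp only at h
    obtain ⟨M, hM⟩ := hbdd (2 * (2 * r₀))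
    have hlim : Tendsto (fun q : ℝ × ℝ =>
        max M 0 * (2 * (2 * r₀) * |q.1⁻¹ - r₀⁻¹| + |q.2 - t₀|)) (𝓝 (r₀, t₀)) (𝓝 0) := by
      have : ContinuousAt (fun q : ℝ × ℝ =>
          max M 0 * (2 * (2 * r₀) * |q.1⁻¹ - r₀⁻¹| + |q.2 - t₀|)) (r₀, t₀) := by
        have : ContinuousAt (fun q : ℝ × ℝ => q.1⁻¹) (r₀, t₀) :=
          continuousAt_fst.inv₀ h.ne'
        fun_prop
      simpa [ContinuousAt] using this
    rw [ContinuousAt, tendsto_iff_dist_tendsto_zero]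
    refine squeeze_zero' (Eventually.of_forall fun _ => dist_nonneg) ?_ hlim
    have h1 : ∀ᶠ q : ℝ × ℝ in 𝓝 (r₀, t₀), q.1 < 2 * r₀ :=
      continuous_fst.continuousAt.eventually (gt_mem_nhds (by dsimp only; linarith))
    have h2 : ∀ᶠ q : ℝ × ℝ in 𝓝 (r₀, t₀), 0 < q.1 :=
      continuous_fst.continuousAt.eventually (lt_mem_nhds h)
    filter_upwards [h1, h2] with q hq1 hq2
    have hM' : ∀ i, s i ≤ 2 * (2 * r₀) → ∀ τ, 0 ≤ τ → D i τ ≤ max M 0 :=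
      fun i hi τ hτ => (hM i hi τ hτ).trans (le_max_left _ _)
    have e1 := envelope_le_add (t := q.2) (t' := t₀) hs hD hbdd hq2 h hq1.le (le_max_right _ _) hM'
    have e2 := envelope_le_add (t := t₀) (t' := q.2) hs hD hbdd h hq2 (by linarith)
      (le_max_right _ _) hM'
    rw [abs_sub_comm r₀⁻¹, abs_sub_comm t₀] at e2
    rw [Real.dist_eq, abs_le]
    constructor <;> linarith

/-- A family of curves which is uniformly bounded, stable and attractive, in terms of the initial
sizes `s i`, has a common bound of class `𝓚𝓛`. -/
theorem exists_isKL (hs : ∀ i, 0 < s i) (hD : ∀ i τ, 0 ≤ τ → 0 ≤ D i τ)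
    (hbdd : ∀ r, ∃ M, ∀ i, s i ≤ r → ∀ τ, 0 ≤ τ → D i τ ≤ M)
    (hsmall : ∀ ε > 0, ∃ r > 0, ∀ i, s i ≤ r → ∀ τ, 0 ≤ τ → D i τ ≤ ε)
    (hattr : ∀ r, ∀ ε > 0, ∃ T, ∀ i, s i ≤ r → ∀ τ, 0 ≤ τ → T ≤ τ → D i τ ≤ ε) :
    ∃ β : ℝ → ℝ → ℝ, IsKL β ∧ ∀ i τ, 0 ≤ τ → D i τ ≤ β (s i) τ := by
  -- The envelope is only weakly monotone in `r` and may be bounded; the added term supplies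
  -- strictness and unboundedness and still decays in `t`.
  refine ⟨fun r t => envelope s D r t + r * Real.exp (-t), ?_, fun i τ hτ => ?_⟩
  · constructor
    · exact (continuousOn_envelope hs hD hbdd hsmall).add (by fun_prop)
    · intro r hr t _
      have := envelope_nonneg (s := s) hD r t
      positivity
    · intro t _
      simp [envelope]
    · intro t _ r _ r' _ hrr'
      exact add_lt_add_of_le_of_lt (envelope_mono_left hs hD hbdd t hrr'.le)
        (mul_lt_mul_of_pos_right hrr' (Real.exp_pos _))
    · rintro t _ ⟨B, hB⟩
      have := hB ⟨(|B| + 1) * Real.exp t, mem_Ici.2 (by positivity), rfl⟩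
      dsimp only at this
      rw [mul_assoc, ← Real.exp_add, add_neg_cancel, Real.exp_zero, mul_one] at this
      have h2 := envelope_nonneg (s := s) hD ((|B| + 1) * Real.exp t) t
      linarith [le_abs_self B]
    · intro r hr t _ t' _ htt'
      exact add_le_add (envelope_anti_right hD hbdd r htt')
        (mul_le_mul_of_nonneg_left (Real.exp_le_exp.2 (neg_le_neg htt')) hr)
    · intro r _
      have h1 : Tendsto (fun t => envelope s D r t) atTop (𝓝 0) := by
        rw [Metric.tendsto_nhds]
        intro ε hε
        obtain ⟨T, hT⟩ := hattr (2 * r) (ε / 2) (by positivity)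
        filter_upwards [eventually_ge_atTop (T + 1)] with t ht
        rw [Real.dist_0_eq_abs, abs_of_nonneg (envelope_nonneg hD _ _)]
        exact (envelope_le hD (by positivity) fun i hi τ hτ hτ' =>
          hT i hi τ hτ (by linarith)).trans_lt (half_lt_self hε)
      have h2 : Tendsto (fun t : ℝ => r * Real.exp (-t)) atTop (𝓝 (r * 0)) :=
        (Real.tendsto_exp_atBot.comp tendsto_neg_atTop_atBot).const_mul r
      simpa using h1.add h2
  · have := le_envelope hs hD hbdd i hτ
    have h2 := (mul_pos (hs i) (Real.exp_pos (-τ))).le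
    linarith

end KL

/-! ### Comparison of `U` with the distance to the target -/

section Target

variable {n m : ℕ} {C : Set (E n)} {A : Set (E m)} {f : E n → E m → E n} {l : E n → E m → ℝ}
  {U : E n → ℝ} {p₀ : ℝ}

/-- The connected segment from `x` to `y` cannot be split between the interior of `S` and the
complement of its closure. -/
theorem exists_mem_frontier_dist_le {V : Type*} [NormedAddCommGroup V] [NormedSpace ℝ V]
    {S : Set V} {x y : V} (hx : x ∉ S) (hy : y ∈ S) : ∃ w ∈ frontier S, dist x w ≤ dist x y := by
  obtain ⟨w, hw, hwS⟩ : (segment ℝ x y ∩ frontier S).Nonempty := by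
    have hpre : IsPreconnected (segment ℝ x y) := (convex_segment x y).isPreconnected
    by_contra hne
    rw [not_nonempty_iff_eq_empty] at hne
    have hsub : segment ℝ x y ⊆ interior S ∪ (closure S)ᶜ := by
      intro z hz
      by_contra hz'
      rw [mem_union, not_or, mem_compl_iff, not_not] at hz'
      exact (hne ▸ (⟨hz, hz'.2, hz'.1⟩ : z ∈ segment ℝ x y ∩ frontier S) : z ∈ (∅ : Set V))
    rcases hpre.subset_or_subset isOpen_interior isClosed_closure.isOpen_compl
      (disjoint_compl_right.mono_left (interior_subset.trans subset_closure)) hsub with h | h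
    · exact hx (interior_subset (h (left_mem_segment ℝ x y)))
    · exact h (right_mem_segment ℝ x y) (subset_closure hy)
  refine ⟨w, hwS, ?_⟩
  have := dist_add_dist_of_mem_segment hw
  linarith [dist_nonneg (x := w) (y := y)]

theorem closure_compl_subset : closure Cᶜ ⊆ Cᶜ ∪ frontier C := by
  intro x hx
  by_cases h : x ∈ C
  · exact Or.inr ⟨subset_closure h, by rwa [closure_compl] at hx⟩
  · exact Or.inl h

theorem infDist_pos (hC : IsClosed C) (hne : C.Nonempty) {x : E n} (hx : x ∈ Cᶜ) :
    0 < Metric.infDist x C :=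
  (hC.notMem_iff_infDist_pos hne).1 hx

/-- A point outside `C` is at least as close to the boundary as to its nearest point of `C`, so the
set lies in a closed thickening of the compact boundary. -/
theorem isCompact_closure_compl_inter (hC : IsClosed C) (hCb : IsCompact (frontier C))
    (hne : C.Nonempty) (r : ℝ) : IsCompact (closure Cᶜ ∩ {x | Metric.infDist x C ≤ r}) := by
  refine IsCompact.of_isClosed_subset (hCb.cthickening (r := max r 0)) (isClosed_closure.inter
    (isClosed_le (Metric.continuous_infDist_pt C) continuous_const)) ?_
  rintro x ⟨hx, hxr⟩
  rcases closure_compl_subset hx with h | h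
  · obtain ⟨y, hy, hxy⟩ := hC.exists_infDist_eq_dist hne x
    obtain ⟨w, hw, hxw⟩ := exists_mem_frontier_dist_le h hy
    refine Metric.mem_cthickening_of_dist_le _ _ _ _ hw (hxw.trans ?_)
    rw [← hxy]
    exact hxr.trans (le_max_left _ _)
  · exact Metric.self_subset_cthickening _ h

namespace IsMRFWith

variable (hU : IsMRFWith C A f l U p₀)
include hU

/-- A positive lower level excludes the boundary, where `U = 0`; properness then gives compactness
inside the open set `Cᶜ` itself. -/
theorem isCompact_level {a : ℝ} (ha : 0 < a) (b : ℝ) :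
    IsCompact (Cᶜ ∩ U ⁻¹' Icc a b) := by
  convert hU.properOn (Icc a b) (fun u hu => ha.le.trans hu.1) isCompact_Icc using 1
  ext x
  refine ⟨fun h => ⟨subset_closure h.1, h.2⟩, fun h => ⟨?_, h.2⟩⟩
  rcases closure_compl_subset h.1 with h' | h'
  · exact h'
  · have := h.2.1
    rw [hU.posDefOn.2 x h'] at this
    linarith

/-- Points where `U` is small are close to the target. -/
theorem exists_lt_imp_infDist_lt {ε : ℝ} (hε : 0 < ε) :
    ∃ η > 0, ∀ x ∈ Cᶜ, U x < η → Metric.infDist x C < ε := by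
  have hK : IsCompact ((closure Cᶜ ∩ U ⁻¹' Icc 0 1) ∩ {x | ε ≤ Metric.infDist x C}) :=
    (hU.properOn (Icc 0 1) (fun u hu => hu.1) isCompact_Icc).inter_right
      (isClosed_le continuous_const (Metric.continuous_infDist_pt C))
  have hpos : ∀ x ∈ (closure Cᶜ ∩ U ⁻¹' Icc 0 1) ∩ {x | ε ≤ Metric.infDist x C}, 0 < U x := by
    intro x hx
    refine hU.posDefOn.1 x fun hxC => ?_
    have := hx.2
    rw [mem_ofPred_eq, Metric.infDist_zero_of_mem hxC] at this
    linarith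
  rcases eq_empty_or_nonempty ((closure Cᶜ ∩ U ⁻¹' Icc 0 1) ∩ {x | ε ≤ Metric.infDist x C})
    with he | hne
  · refine ⟨1, one_pos, fun x hx hx1 => ?_⟩
    by_contra h
    have : x ∈ (closure Cᶜ ∩ U ⁻¹' Icc 0 1) ∩ {x | ε ≤ Metric.infDist x C} :=
      ⟨⟨subset_closure hx, (hU.posDefOn.1 x hx).le, hx1.le⟩, not_lt.1 h⟩
    rw [he] at this
    exact this
  · obtain ⟨y, hy, hmin⟩ := hK.exists_isMinOn hne
      (hU.continuousOn.mono fun x hx => hx.1.1)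
    refine ⟨min 1 (U y), lt_min one_pos (hpos y hy), fun x hx hx1 => ?_⟩
    by_contra h
    have := isMinOn_iff.1 hmin x ⟨⟨subset_closure hx, (hU.posDefOn.1 x hx).le,
      (hx1.trans_le (min_le_left _ _)).le⟩, not_lt.1 h⟩
    exact absurd (hx1.trans_le (min_le_right _ _)) (not_lt.2 this)

theorem exists_le_of_infDist_le (hC : IsClosed C) (hCb : IsCompact (frontier C))
    (hne : C.Nonempty) (r : ℝ) : ∃ b, ∀ x ∈ Cᶜ, Metric.infDist x C ≤ r → U x ≤ b := by
  obtain ⟨b, hb⟩ := ((isCompact_closure_compl_inter hC hCb hne r).image_of_continuousOn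
    (hU.continuousOn.mono inter_subset_left)).bddAbove
  exact ⟨b, fun x hx hxr => hb (mem_image_of_mem _ ⟨subset_closure hx, hxr⟩)⟩

theorem exists_infDist_le_of_le (b : ℝ) :
    ∃ M, ∀ x ∈ Cᶜ, U x ≤ b → Metric.infDist x C ≤ M := by
  obtain ⟨M, hM⟩ := ((hU.properOn (Icc 0 b) (fun u hu => hu.1) isCompact_Icc).image
    (Metric.continuous_infDist_pt C)).bddAbove
  exact ⟨M, fun x hx hxb =>
    hM (mem_image_of_mem _ ⟨subset_closure hx, (hU.posDefOn.1 x hx).le, hxb⟩)⟩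

/-- `U` is small at points close to the target. -/
theorem exists_infDist_le_imp_lt (hC : IsClosed C) (hCb : IsCompact (frontier C))
    (hne : C.Nonempty) {η : ℝ} (hη : 0 < η) :
    ∃ r > 0, ∀ x ∈ Cᶜ, Metric.infDist x C ≤ r → U x < η := by
  -- Capping `U` by `b` within distance `1` confines possible counterexamples to a compact band, on
  -- which the distance to `C` has a positive minimum.
  obtain ⟨b, hb⟩ := hU.exists_le_of_infDist_le hC hCb hne 1
  have hK := hU.isCompact_level hη b
  rcases (Cᶜ ∩ U ⁻¹' Icc η b).eq_empty_or_nonempty with he | hn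
  · refine ⟨1, one_pos, fun x hx hx1 => ?_⟩
    by_contra h
    have : x ∈ Cᶜ ∩ U ⁻¹' Icc η b := ⟨hx, not_lt.1 h, hb x hx hx1⟩
    rw [he] at this
    exact this
  · obtain ⟨y, hy, hmin⟩ := hK.exists_isMinOn hn (Metric.continuous_infDist_pt C).continuousOn
    have hy0 := infDist_pos hC hne hy.1
    refine ⟨min 1 (Metric.infDist y C / 2), lt_min one_pos (half_pos hy0), fun x hx hx1 => ?_⟩
    by_contra h
    have := isMinOn_iff.1 hmin x ⟨hx, not_lt.1 h, hb x hx (hx1.trans (min_le_left _ _))⟩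
    linarith [hx1.trans (min_le_right _ _)]

end IsMRFWith

end Target

/-! ### Local descent of `U` with a constant control -/

section Descent

variable {n m : ℕ} {C : Set (E n)} {A : Set (E m)} {f : E n → E m → E n} {l : E n → E m → ℝ}
  {U : E n → ℝ} {p₀ : ℝ}

theorem exists_lt_zero_of_hamiltonian_neg {x p : E n} (h : hamiltonian A f l x p₀ p < 0) :
    ∃ a ∈ A, p₀ * l x a + inner ℝ p (f x a) < 0 := by
  -- The real infimum of the empty set is `0`, so a negative value forces `A` to be nonempty.
  have hne : ((fun a => p₀ * l x a + inner ℝ p (f x a)) '' A).Nonempty := by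
    by_contra hne
    rw [not_nonempty_iff_eq_empty] at hne
    rw [hamiltonian, hne, Real.sInf_empty] at h
    exact lt_irrefl _ h
  obtain ⟨_, ⟨a, ha, rfl⟩, hlt⟩ := exists_lt_of_csInf_lt hne h
  exact ⟨a, ha, hlt⟩

/-- Near each point of `Ω`, the gradients of `F` at the points of differentiability admit
controls with a uniform rate of decrease. -/
theorem exists_uniform_rate_of_gradient {Ω : Set (E n)} {F : E n → ℝ} (hΩ : IsOpen Ω)
    (hlf : ContinuousOn (fun q : E n × E m => (l q.1 q.2, f q.1 q.2)) (Ω ×ˢ A))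
    {x₀ : E n} (hx₀ : x₀ ∈ Ω)
    (hH : ∀ p ∈ limitingGradient Ω F x₀, hamiltonian A f l x₀ p₀ p < 0)
    {r M : ℝ} (hr : 0 < r) (hrΩ : Metric.ball x₀ r ⊆ Ω)
    (hM : ∀ y ∈ Metric.ball x₀ r, ‖gradient F y‖ ≤ M) :
    ∃ c > 0, ∃ ρ > 0, ρ ≤ r ∧ ∀ y ∈ Metric.ball x₀ ρ, y ≠ x₀ → DifferentiableAt ℝ F y →
      ∃ a ∈ A, p₀ * l y a + inner ℝ (gradient F y) (f y a) ≤ -c := by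
  by_contra hcon
  push Not at hcon
  have hk : ∀ k : ℕ, (0 : ℝ) < 1 / (k + 1) := fun k => Nat.one_div_pos_of_nat
  have hmul : ∀ k : ℕ, r * (1 / ((k : ℝ) + 1)) ≤ r := fun k =>
    mul_le_of_le_one_right hr.le (by
      rw [div_le_one (by positivity)]
      have : (0 : ℝ) ≤ k := k.cast_nonneg
      linarith)
  choose y hy hyne hyd hya using fun k : ℕ =>
    hcon (1 / (k + 1)) (hk k) (r * (1 / (k + 1))) (mul_pos hr (hk k)) (hmul k)
  have hyr : ∀ k, y k ∈ Metric.ball x₀ r := fun k => Metric.ball_subset_ball (hmul k) (hy k)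
  have hylim : Tendsto y atTop (𝓝 x₀) := by
    rw [tendsto_iff_dist_tendsto_zero]
    refine squeeze_zero (fun _ => dist_nonneg) (fun k => (Metric.mem_ball.1 (hy k)).le) ?_
    simpa using tendsto_one_div_add_atTop_nhds_zero_nat.const_mul r
  obtain ⟨p, -, φ, hφ, hp⟩ := (isCompact_closedBall (0 : E n) M).tendsto_subseq
    (x := fun k => gradient F (y k)) (fun k => by simpa using hM _ (hyr k))
  obtain ⟨a, ha, hneg⟩ := exists_lt_zero_of_hamiltonian_neg (hH p
    ⟨y ∘ φ, fun k => ⟨hrΩ (hyr _), hyne _, hyd _⟩, hylim.comp hφ.tendsto_atTop, hp⟩)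
  have hcont : ContinuousAt (fun x => (l x a, f x a)) x₀ := by
    have h1 : ContinuousOn (fun x => (l x a, f x a)) Ω :=
      hlf.comp (f := fun x => (x, a)) (by fun_prop) fun x hx => ⟨hx, ha⟩
    exact h1.continuousAt (hΩ.mem_nhds hx₀)
  have hyφ := hylim.comp hφ.tendsto_atTop
  have hlim1 : Tendsto (fun k => l (y (φ k)) a) atTop (𝓝 (l x₀ a)) :=
    (continuous_fst.continuousAt.comp hcont).tendsto.comp hyφ
  have hlim2 : Tendsto (fun k => f (y (φ k)) a) atTop (𝓝 (f x₀ a)) :=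
    (continuous_snd.continuousAt.comp hcont).tendsto.comp hyφ
  have hlim : Tendsto (fun k => p₀ * l (y (φ k)) a +
      inner ℝ (gradient F (y (φ k))) (f (y (φ k)) a)) atTop
      (𝓝 (p₀ * l x₀ a + inner ℝ p (f x₀ a))) := (hlim1.const_mul p₀).add (hp.inner hlim2)
  have hlim0 : Tendsto (fun k => -(1 / ((φ k : ℝ) + 1))) atTop (𝓝 (-0)) :=
    (tendsto_one_div_add_atTop_nhds_zero_nat.comp hφ.tendsto_atTop).neg
  have := le_of_tendsto_of_tendsto' hlim0 hlim fun k => (hya (φ k) a ha).le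
  linarith

/-- A local supergradient `p` of `F` at each point, with a control which makes the
pre-Hamiltonian negative, with uniform constants. -/
theorem exists_uniform_descent_direction (hn : 0 < n) {Ω : Set (E n)} {F : E n → ℝ}
    (hΩ : IsOpen Ω) (hA : IsCompact A)
    (hlf : ContinuousOn (fun q : E n × E m => (l q.1 q.2, f q.1 q.2)) (Ω ×ˢ A))
    (hF : LocallySemiconcaveOn Ω F) {x₀ : E n} (hx₀ : x₀ ∈ Ω)
    (hH : ∀ p ∈ limitingGradient Ω F x₀, hamiltonian A f l x₀ p₀ p < 0) :
    ∃ ρ > 0, Metric.ball x₀ ρ ⊆ Ω ∧ ∃ R > 0, ∃ M ≥ 0, ∃ c > 0, ∀ x ∈ Metric.ball x₀ ρ,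
      ∃ p, ‖p‖ ≤ M ∧ (∃ a ∈ A, p₀ * l x a + inner ℝ p (f x a) ≤ -c) ∧
        ∀ y ∈ Metric.ball x₀ ρ, F y ≤ F x + inner ℝ p (y - x) + R * ‖y - x‖ ^ 2 := by
  obtain ⟨R, hR, r₁, hr₁, hr₁Ω, hsemi⟩ := hF.2 x₀ hx₀
  have hFc : ContinuousOn F (Metric.ball x₀ r₁) := hF.1.mono hr₁Ω
  have hconc := concaveOn_sub_sq_of_semiconcave (convex_ball x₀ r₁) hFc hsemi x₀
  -- A concave function is locally Lipschitz, and so is the paraboloid; hence `F` is Lipschitz near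
  -- `x₀`, which bounds its gradients and gives differentiability almost everywhere.
  obtain ⟨r, hr, hrr₁, K, hK⟩ : ∃ r > 0, r ≤ r₁ ∧ ∃ K, LipschitzOnWith K F (Metric.ball x₀ r) := by
    obtain ⟨K, t, ht, hK⟩ := hconc.locallyLipschitzOn Metric.isOpen_ball
      (Metric.mem_ball_self hr₁)
    obtain ⟨K', t', ht', hK'⟩ : ∃ K', ∃ t' ∈ 𝓝 x₀,
        LipschitzOnWith K' (fun y => 2 * R * ‖y - x₀‖ ^ 2) t' := by
      have : ContDiff ℝ 1 (fun y : E n => 2 * R * ‖y - x₀‖ ^ 2) :=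
        contDiff_const.mul ((contDiff_id.sub contDiff_const).norm_sq ℝ)
      exact this.contDiffAt.exists_lipschitzOnWith
    rw [Metric.isOpen_ball.nhdsWithin_eq (Metric.mem_ball_self hr₁)] at ht
    obtain ⟨r, hr, hrt⟩ := Metric.mem_nhds_iff.1 (inter_mem ht ht')
    refine ⟨min r r₁, lt_min hr hr₁, min_le_right _ _, K + K', ?_⟩
    have hsub := (Metric.ball_subset_ball (min_le_left r r₁)).trans hrt
    have := (hK.mono (hsub.trans inter_subset_left)).add (hK'.mono (hsub.trans inter_subset_right))
    simpa using this
  have hgrad : ∀ y ∈ Metric.ball x₀ r, ‖gradient F y‖ ≤ K := by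
    intro y hy
    rw [gradient, LinearIsometryEquiv.norm_map]
    exact norm_fderiv_le_of_lipschitzOn ℝ (Metric.isOpen_ball.mem_nhds hy) hK
  obtain ⟨c, hc, ρ, hρ, hρr, hrate⟩ := exists_uniform_rate_of_gradient hΩ hlf hx₀ hH hr
    ((Metric.ball_subset_ball hrr₁).trans hr₁Ω) hgrad
  have hρr₁ : Metric.ball x₀ ρ ⊆ Metric.ball x₀ r₁ := Metric.ball_subset_ball (hρr.trans hrr₁)
  refine ⟨ρ, hρ, hρr₁.trans hr₁Ω, 2 * R, by positivity, K, K.2, c, hc, fun x hx => ?_⟩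
  -- Positive dimension makes the single point `x₀` a null set, so it can be discarded along with
  -- the points of nondifferentiability.
  have hne : Nonempty (Fin n) := ⟨⟨0, hn⟩⟩
  have hdense :
      x ∈ closure {y | y ∈ Metric.ball x₀ ρ ∧ y ≠ x₀ ∧ DifferentiableAt ℝ F y} := by
    have hae : ∀ᵐ y : E n, (y ∈ Metric.ball x₀ r → DifferentiableAt ℝ F y) ∧ y ≠ x₀ := by
      have h1 := hK.ae_differentiableWithinAt_of_mem (μ := volume)
      have h2 : ∀ᵐ y : E n, y ≠ x₀ := by simp [ae_iff]
      filter_upwards [h1, h2] with y hy hy2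
      exact ⟨fun hyr => (hy hyr).differentiableAt (Metric.isOpen_ball.mem_nhds hyr), hy2⟩
    refine closure_mono ?_
      ((Measure.dense_of_ae hae).open_subset_closure_inter Metric.isOpen_ball hx)
    rintro y ⟨hyρ, hyd, hyne⟩
    exact ⟨hyρ, hyne, hyd (Metric.ball_subset_ball hρr hyρ)⟩
  obtain ⟨y, hy, hyx⟩ := mem_closure_iff_seq_limit.1 hdense
  -- The point `x` itself may fail to be differentiable: gradients and controls at differentiability
  -- points `y k → x` have a common convergent subsequence, and both the rate and the paraboloid
  -- bound are closed conditions.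
  choose a haA hac using fun k => hrate (y k) (hy k).1 (hy k).2.1 (hy k).2.2
  obtain ⟨⟨p, b⟩, hpb, φ, hφ, hlim⟩ := ((isCompact_closedBall (0 : E n) K).prod hA).tendsto_subseq
    (x := fun k => (gradient F (y k), a k))
    (fun k => ⟨by simpa using hgrad _ (Metric.ball_subset_ball hρr (hy k).1), haA k⟩)
  have hp : Tendsto (fun k => gradient F (y (φ k))) atTop (𝓝 p) :=
    (continuous_fst.tendsto _).comp hlim
  have hb : Tendsto (fun k => a (φ k)) atTop (𝓝 b) := (continuous_snd.tendsto _).comp hlim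
  have hyφ : Tendsto (fun k => y (φ k)) atTop (𝓝 x) := hyx.comp hφ.tendsto_atTop
  have hxΩ : x ∈ Ω := hr₁Ω (hρr₁ hx)
  have hlfx := (hlf (x, b) ⟨hxΩ, hpb.2⟩).tendsto.comp (tendsto_nhdsWithin_iff.2
    ⟨hyφ.prodMk_nhds hb, Eventually.of_forall fun k => ⟨hr₁Ω (hρr₁ (hy _).1), haA _⟩⟩)
  have hl1 : Tendsto (fun k => l (y (φ k)) (a (φ k))) atTop (𝓝 (l x b)) :=
    (continuous_fst.tendsto _).comp hlfx
  have hf1 : Tendsto (fun k => f (y (φ k)) (a (φ k))) atTop (𝓝 (f x b)) :=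
    (continuous_snd.tendsto _).comp hlfx
  refine ⟨p, by simpa using hpb.1, ⟨b, hpb.2, ?_⟩, fun z hz => ?_⟩
  · exact le_of_tendsto' ((hl1.const_mul p₀).add (hp.inner hf1)) fun k => hac _
  · have hFx : Tendsto (fun k => F (y (φ k))) atTop (𝓝 (F x)) :=
      (hF.1.continuousAt (hΩ.mem_nhds hxΩ)).tendsto.comp hyφ
    have hzy : Tendsto (fun k => z - y (φ k)) atTop (𝓝 (z - x)) := hyφ.const_sub z
    refine ge_of_tendsto' ((hFx.add (hp.inner hzy)).add ((hzy.norm.pow 2).const_mul (2 * R)))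
      fun k => ?_
    exact le_gradient_of_semiconcave (convex_ball x₀ r₁) hFc hsemi (hρr₁ (hy _).1) (hρr₁ hz)
      (hy _).2.2

/-- A piece of trajectory of length `s` with constant control, along which `U` plus `p₀` times
the cost decreases with the rate `s` at least. -/
def HasDescentStep (C : Set (E n)) (A : Set (E m)) (f : E n → E m → E n) (l : E n → E m → ℝ)
    (U : E n → ℝ) (p₀ : ℝ) (x : E n) (s : ℝ) : Prop :=
  0 < s ∧ s ≤ 1 ∧ ∃ a ∈ A, ∃ z : ℝ → E n, Continuous z ∧ z 0 = x ∧ ∀ t ∈ Icc 0 s, z t ∈ Cᶜ ∧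
    z t = x + (∫ r in (0 : ℝ)..t, f (z r) a) ∧
    U (z t) + p₀ * (∫ r in (0 : ℝ)..t, l (z r) a) ≤ U x - s * t

/-- Freeze the control chosen at `x` along a Peano solution. Of the rate `c`, one quarter pays for
the variation of `l` and `f` along the curve and one quarter for the quadratic term of the
paraboloid; what remains exceeds the required rate `s ≤ c / 4`. -/
theorem exists_hasDescentStep_nhds (hn : 0 < n) (hC : IsClosed C) (hA : IsCompact A)
    (hlf : ContinuousOn (fun q : E n × E m => (l q.1 q.2, f q.1 q.2)) (Cᶜ ×ˢ A))
    (hU : IsMRFWith C A f l U p₀) {x₀ : E n} (hx₀ : x₀ ∈ Cᶜ) :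
    ∃ s, ∃ W ∈ 𝓝 x₀, ∀ x ∈ W, HasDescentStep C A f l U p₀ x s := by
  obtain ⟨ρ, hρ, hρC, R, hR, M, hM, c, hc, hdir⟩ := exists_uniform_descent_direction hn
    hC.isOpen_compl hA hlf hU.locallySemiconcaveOn hx₀ (hU.hamiltonian_neg x₀ hx₀)
  have hp₀ := hU.nonneg
  have hball : Metric.closedBall x₀ (ρ / 2) ⊆ Metric.ball x₀ ρ :=
    Metric.closedBall_subset_ball (half_lt_self hρ)
  have hlfB := hlf.mono (prod_mono (hball.trans hρC) (Subset.refl A))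
  have hKc : IsCompact (Metric.closedBall x₀ (ρ / 2) ×ˢ A) := (isCompact_closedBall _ _).prod hA
  obtain ⟨F, hF1, hF⟩ : ∃ F : ℝ, 1 ≤ F ∧ ∀ x ∈ Metric.closedBall x₀ (ρ / 2), ∀ a ∈ A,
      ‖f x a‖ ≤ F := by
    obtain ⟨F, hF⟩ := hKc.exists_bound_of_continuousOn hlfB.snd
    exact ⟨max F 1, le_max_right _ _, fun x hx a ha => (hF (x, a) ⟨hx, ha⟩).trans (le_max_left _ _)⟩
  set ε := c / (4 * (p₀ + M + 1)) with hεdef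
  have hε : 0 < ε := by positivity
  obtain ⟨η, hη, hunif⟩ := Metric.uniformContinuousOn_iff.1
    (hKc.uniformContinuousOn_of_continuous hlfB) ε hε
  set r := min (ρ / 4) (η / 2) with hrdef
  have hr : 0 < r := lt_min (by positivity) (by positivity)
  -- The four bounds on `s` normalise the length, keep the curve in the ball of radius `r`, make the
  -- rate affordable, and control `R (F t) ^ 2` by `c t / 4`.
  set s := min (min 1 (r / F)) (min (c / 4) (c / (4 * R * F ^ 2))) with hsdef
  have hF0 : 0 < F := by linarith
  have hs : 0 < s := lt_min (lt_min one_pos (by positivity)) (lt_min (by positivity)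
    (by positivity))
  have hs1 : s ≤ 1 := (min_le_left _ _).trans (min_le_left _ _)
  have hsF : F * s ≤ r := by
    have : s ≤ r / F := (min_le_left _ _).trans (min_le_right _ _)
    rw [le_div_iff₀ hF0] at this
    linarith
  have hsc : s ≤ c / 4 := (min_le_right _ _).trans (min_le_left _ _)
  have hsR : R * F ^ 2 * s ≤ c / 4 := by
    have : s ≤ c / (4 * R * F ^ 2) := (min_le_right _ _).trans (min_le_right _ _)
    rw [le_div_iff₀ (by positivity)] at this
    linarith
  refine ⟨s, Metric.ball x₀ (ρ / 4), Metric.ball_mem_nhds _ (by positivity), fun x hx => ?_⟩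
  obtain ⟨p, hpM, ⟨a, ha, hac⟩, hsup⟩ := hdir x (Metric.ball_subset_ball (by linarith) hx)
  have hsub : Metric.closedBall x r ⊆ Metric.closedBall x₀ (ρ / 2) := by
    refine Metric.closedBall_subset_closedBall' ?_
    have := Metric.mem_ball.1 hx
    linarith [min_le_left (ρ / 4) (η / 2)]
  have hlc : ContinuousOn (fun y => l y a) (Metric.closedBall x r) :=
    hlfB.fst.comp (f := fun y => (y, a)) (by fun_prop) fun y hy => ⟨hsub hy, ha⟩
  have hfc : ContinuousOn (fun y => f y a) (Metric.closedBall x r) :=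
    hlfB.snd.comp (f := fun y => (y, a)) (by fun_prop) fun y hy => ⟨hsub hy, ha⟩
  obtain ⟨z, hz, hz0, hzF, hzsol⟩ := exists_solution_of_continuousOn_closedBall (g := fun y => f y a)
    (fun y hy => hF y (hsub hy) a ha) hF0 hfc hsF
  have hzr : ∀ t ∈ Icc 0 s, z t ∈ Metric.closedBall x r := fun t ht => by
    rw [mem_closedBall_iff_norm]
    exact (hzF t ht).trans ((mul_le_mul_of_nonneg_left ht.2 hF0.le).trans hsF)
  refine ⟨hs, hs1, a, ha, z, hz, hz0, fun t ht => ⟨hρC (hball (hsub (hzr t ht))), hzsol t ht, ?_⟩⟩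
  have hts : uIcc 0 t ⊆ Icc 0 s := by
    rw [uIcc_of_le ht.1]
    exact Icc_subset_Icc_right ht.2
  have hli : IntervalIntegrable (fun τ => l (z τ) a) volume 0 t :=
    (hlc.comp hz.continuousOn fun τ hτ => hzr τ (hts hτ)).intervalIntegrable
  have hfi : IntervalIntegrable (fun τ => f (z τ) a) volume 0 t :=
    (hfc.comp hz.continuousOn fun τ hτ => hzr τ (hts hτ)).intervalIntegrable
  have hpfi : IntervalIntegrable (fun τ => inner ℝ p (f (z τ) a)) volume 0 t :=
    (ContinuousOn.inner continuousOn_const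
      (hfc.comp hz.continuousOn fun τ hτ => hzr τ (hts hτ))).intervalIntegrable
  have hinner : inner ℝ p (z t - x) = ∫ τ in (0 : ℝ)..t, inner ℝ p (f (z τ) a) := by
    have := (innerSL ℝ p).intervalIntegral_comp_comm hfi
    simp only [innerSL_apply_apply] at this
    rw [this, hzsol t ht, add_sub_cancel_left]
  have hint : ∫ τ in (0 : ℝ)..t, (p₀ * l (z τ) a + inner ℝ p (f (z τ) a)) ≤
      ∫ _ in (0 : ℝ)..t, (-(3 * c / 4)) := by
    refine intervalIntegral.integral_mono_on ht.1 ((hli.const_mul p₀).add hpfi)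
      intervalIntegrable_const fun τ hτ => ?_
    have hτs : τ ∈ Icc 0 s := ⟨hτ.1, hτ.2.trans ht.2⟩
    have hclose := hunif (z τ, a) ⟨hsub (hzr τ hτs), ha⟩ (x, a)
      ⟨hsub (Metric.mem_closedBall_self hr.le), ha⟩ (by
        rw [Prod.dist_eq, dist_self, max_eq_left dist_nonneg]
        have := Metric.mem_closedBall.1 (hzr τ hτs)
        linarith [min_le_right (ρ / 4) (η / 2)])
    rw [Prod.dist_eq, max_lt_iff, Real.dist_eq, dist_eq_norm] at hclose
    have h1 : l (z τ) a - l x a ≤ ε := (le_abs_self _).trans hclose.1.le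
    have h2 : inner ℝ p (f (z τ) a) - inner ℝ p (f x a) ≤ M * ε := by
      rw [← inner_sub_right]
      exact (real_inner_le_norm _ _).trans
        (mul_le_mul hpM hclose.2.le (norm_nonneg _) hM)
    have h3 : (p₀ + M) * ε ≤ c / 4 := by
      rw [hεdef, mul_div_assoc', div_le_div_iff₀ (by positivity) (by norm_num)]
      nlinarith
    nlinarith [mul_le_mul_of_nonneg_left h1 hp₀]
  rw [intervalIntegral.integral_add (hli.const_mul p₀) hpfi,
    intervalIntegral.integral_const_mul, ← hinner, intervalIntegral.integral_const] at hint
  have hsupt := hsup (z t) (hball (hsub (hzr t ht)))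
  have hquad : R * ‖z t - x‖ ^ 2 ≤ c / 4 * t := by
    have h1 : ‖z t - x‖ ^ 2 ≤ (F * t) ^ 2 := pow_le_pow_left₀ (norm_nonneg _) (hzF t ht) 2
    have h2 : R * ‖z t - x‖ ^ 2 ≤ R * (F * t) ^ 2 := mul_le_mul_of_nonneg_left h1 hR.le
    have h3 : R * (F * t) ^ 2 = R * F ^ 2 * t * t := by ring
    have h4 : R * F ^ 2 * t * t ≤ c / 4 * t := mul_le_mul_of_nonneg_right
      ((mul_le_mul_of_nonneg_left ht.2 (by positivity)).trans hsR) ht.1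
    linarith
  have h5 : s * t ≤ c / 4 * t := mul_le_mul_of_nonneg_right hsc ht.1
  have h6 : 0 ≤ c * t := mul_nonneg hc.le ht.1
  rw [smul_eq_mul, sub_zero] at hint
  linarith

/-- Step lengths for all initial points, bounded away from zero on compact sets. -/
theorem exists_stepLength (hn : 0 < n) (hC : IsClosed C) (hA : IsCompact A)
    (hlf : ContinuousOn (fun q : E n × E m => (l q.1 q.2, f q.1 q.2)) (Cᶜ ×ˢ A))
    (hU : IsMRFWith C A f l U p₀) :
    ∃ σ : E n → ℝ, (∀ x ∈ Cᶜ, HasDescentStep C A f l U p₀ x (σ x)) ∧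
      ∀ K ⊆ Cᶜ, IsCompact K → ∃ s > 0, ∀ x ∈ K, s ≤ σ x := by
  -- Taking at least half of every admissible step length at `x` makes any locally uniform length
  -- `s` a local lower bound `s / 2` for the selection.
  have hex : ∀ x : E n, ∃ s : ℝ, x ∈ Cᶜ → HasDescentStep C A f l U p₀ x s ∧
      ∀ s', HasDescentStep C A f l U p₀ x s' → s' / 2 ≤ s := by
    intro x
    by_cases hx : x ∈ Cᶜ
    · obtain ⟨s₀, W, hW, hs₀⟩ := exists_hasDescentStep_nhds hn hC hA hlf hU hx
      have hs₀x := hs₀ x (mem_of_mem_nhds hW)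
      have hbdd : BddAbove {s | HasDescentStep C A f l U p₀ x s} := ⟨1, fun s hs => hs.2.1⟩
      have hpos : 0 < sSup {s | HasDescentStep C A f l U p₀ x s} :=
        hs₀x.1.trans_le (le_csSup hbdd hs₀x)
      obtain ⟨s, hs, hlt⟩ := exists_lt_of_lt_csSup ⟨s₀, hs₀x⟩ (half_lt_self hpos)
      refine ⟨s, fun _ => ⟨hs, fun s' hs' => ?_⟩⟩
      have := le_csSup hbdd hs'
      linarith
    · exact ⟨0, fun h => absurd h hx⟩
  choose σ hσ using hex
  refine ⟨σ, fun x hx => (hσ x hx).1, fun K hKC hK => ?_⟩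
  refine hK.induction_on (p := fun S => ∃ s > 0, ∀ x ∈ S, s ≤ σ x) ⟨1, one_pos, by simp⟩ ?_ ?_ ?_
  · rintro S T hST ⟨s, hs, h⟩
    exact ⟨s, hs, fun x hx => h x (hST hx)⟩
  · rintro S T ⟨s, hs, h⟩ ⟨s', hs', h'⟩
    refine ⟨min s s', lt_min hs hs', ?_⟩
    rintro x (hx | hx)
    · exact (min_le_left _ _).trans (h x hx)
    · exact (min_le_right _ _).trans (h' x hx)
  · intro x hx
    obtain ⟨s, W, hW, hs⟩ := exists_hasDescentStep_nhds hn hC hA hlf hU (hKC hx)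
    refine ⟨W ∩ Cᶜ, inter_mem (mem_nhdsWithin_of_mem_nhds hW)
      (mem_nhdsWithin_of_mem_nhds (hC.isOpen_compl.mem_nhds (hKC hx))), s / 2,
      half_pos (hs x (mem_of_mem_nhds hW)).1, fun y hy => ?_⟩
    exact (hσ y hy.2).2 s (hs y hy.1)

end Descent

/-! ### Concatenation of countably many pieces -/

section Concatenation

variable {n m : ℕ}

/-- The time at which the piece with index `k` begins, for pieces with the lengths `τ j`. -/
noncomputable def switchTime (τ : ℕ → ℝ) (k : ℕ) : ℝ := ∑ j ∈ Finset.range k, τ j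

/-- The time until which infinitely many pieces with the lengths `τ j` last. -/
noncomputable def totalTime (τ : ℕ → ℝ) : EReal := ⨆ k, ((switchTime τ k : ℝ) : EReal)

variable {τ : ℕ → ℝ}

theorem switchTime_zero : switchTime τ 0 = 0 := by simp [switchTime]

theorem switchTime_succ (k : ℕ) : switchTime τ (k + 1) = switchTime τ k + τ k :=
  Finset.sum_range_succ _ _

theorem switchTime_strictMono (hτ : ∀ k, 0 < τ k) : StrictMono (switchTime τ) :=
  strictMono_nat_of_lt_succ fun k => by rw [switchTime_succ]; linarith [hτ k]

theorem switchTime_nonneg (hτ : ∀ k, 0 < τ k) (k : ℕ) : 0 ≤ switchTime τ k :=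
  switchTime_zero (τ := τ) ▸ (switchTime_strictMono hτ).monotone k.zero_le

theorem lt_totalTime_iff {t : ℝ} : (t : EReal) < totalTime τ ↔ ∃ k, t < switchTime τ k := by
  simp [totalTime, lt_iSup_iff]

theorem totalTime_le_iff {t : ℝ} : totalTime τ ≤ (t : EReal) ↔ ∀ k, switchTime τ k ≤ t := by
  simp [totalTime]

theorem switchTime_lt_totalTime (hτ : ∀ k, 0 < τ k) (k : ℕ) :
    ((switchTime τ k : ℝ) : EReal) < totalTime τ :=
  lt_totalTime_iff.2 ⟨k + 1, switchTime_strictMono hτ k.lt_succ_self⟩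

theorem exists_mem_Icc_switchTime {t : ℝ} (ht : t ∈ timeInterval (totalTime τ)) :
    ∃ k, t ∈ Icc (switchTime τ k) (switchTime τ (k + 1)) := by
  classical
  have hex := lt_totalTime_iff.1 ht.2
  have hne : Nat.find hex ≠ 0 := fun h => by
    have := Nat.find_spec hex
    rw [h, switchTime_zero] at this
    exact absurd ht.1 (not_le.2 this)
  obtain ⟨k, hk⟩ := Nat.exists_eq_succ_of_ne_zero hne
  refine ⟨k, not_lt.1 (Nat.find_min hex (by omega)), ?_⟩
  have := Nat.find_spec hex
  rw [hk] at this
  exact this.le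

/-- Concatenation of the curves `ζ k` and of the constant controls `a k`. -/
theorem exists_concatenation (hτ : ∀ k, 0 < τ k) (a : ℕ → E m) (ζ : ℕ → ℝ → E n)
    (hζ : ∀ k, ζ (k + 1) 0 = ζ k (τ k)) (zbar : E n) :
    ∃ (z : ℝ → E n) (α : ℝ → E m), Measurable α ∧ α 0 = a 0 ∧
      (∀ t : ℝ, totalTime τ ≤ (t : EReal) → z t = zbar) ∧
      (∀ k, ∀ t ∈ Ioc (switchTime τ k) (switchTime τ (k + 1)), α t = a k) ∧
      ∀ k, ∀ t ∈ Icc (switchTime τ k) (switchTime τ (k + 1)), z t = ζ k (t - switchTime τ k) := by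
  classical
  have hmono := switchTime_strictMono hτ
  -- The second alternative assigns index `0` to times beyond all switching times, so that the least
  -- index is defined, and measurable, on the whole line.
  have hex : ∀ t : ℝ, ∃ k, t ≤ switchTime τ (k + 1) ∨ ∀ j, switchTime τ (j + 1) < t := by
    intro t
    by_cases h : ∃ k, t ≤ switchTime τ (k + 1)
    · exact h.imp fun k hk => Or.inl hk
    · push Not at h
      exact ⟨0, Or.inr h⟩
  set κ : ℝ → ℕ := fun t => Nat.find (hex t) with hκ
  have hκm : Measurable κ := by
    refine measurable_find hex fun k => ?_
    refine (measurableSet_le measurable_id measurable_const).union ?_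
    have : MeasurableSet {t : ℝ | ∀ j, switchTime τ (j + 1) < t} := by
      simp only [ofPred_forall]
      exact MeasurableSet.iInter fun j => measurableSet_lt measurable_const measurable_id
    exact this
  -- A switching time belongs to the piece that ends there; time `0` ends no piece and is treated
  -- separately.
  have hκeq : ∀ k, ∀ t ∈ Ioc (switchTime τ k) (switchTime τ (k + 1)), κ t = k := by
    intro k t ht
    refine (Nat.find_eq_iff _).2 ⟨Or.inl ht.2, fun j hj h => ?_⟩
    rcases h with h | h
    · exact absurd (h.trans (hmono.monotone hj)) (not_le.2 ht.1)
    · exact absurd (h k) (not_lt.2 ht.2)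
  have hκ0 : κ 0 = 0 := (Nat.find_eq_zero _).2 (Or.inl (switchTime_nonneg hτ _))
  refine ⟨fun t => if totalTime τ ≤ (t : EReal) then zbar else ζ (κ t) (t - switchTime τ (κ t)),
    fun t => a (κ t), measurable_from_nat.comp hκm, by simp only [hκ0], fun t ht => if_pos ht,
    fun k t ht => by simp only [hκeq k t ht], fun k t ht => ?_⟩
  have hlt : ¬ totalTime τ ≤ (t : EReal) := fun h => by
    have := totalTime_le_iff.1 h (k + 2)
    exact absurd (this.trans ht.2) (not_le.2 (hmono (k + 1).lt_succ_self))
  simp only [if_neg hlt]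
  rcases ht.1.eq_or_lt with h | h
  · rw [← h, sub_self]
    cases k with
    | zero => rw [switchTime_zero, hκ0, switchTime_zero, sub_self]
    | succ k =>
      rw [hκeq k _ ⟨hmono k.lt_succ_self, le_rfl⟩, hζ, switchTime_succ, add_sub_cancel_left]
  · rw [hκeq k t ⟨h, ht.2⟩]

variable {C : Set (E n)} {A : Set (E m)} {f : E n → E m → E n} {l : E n → E m → ℝ}

/-- The concatenation of solutions with constant controls is a solution. -/
theorem solution_of_pieces (hτ : ∀ k, 0 < τ k) {a : ℕ → E m} {ζ : ℕ → ℝ → E n}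
    {z : ℝ → E n} {α : ℝ → E m}
    (hα : ∀ k, ∀ t ∈ Ioc (switchTime τ k) (switchTime τ (k + 1)), α t = a k)
    (hz : ∀ k, ∀ t ∈ Icc (switchTime τ k) (switchTime τ (k + 1)),
      z t = ζ k (t - switchTime τ k))
    (hint : ∀ k, ∀ t ∈ Icc 0 (τ k), IntervalIntegrable (fun r => f (ζ k r) (a k)) volume 0 t)
    (hsol : ∀ k, ∀ t ∈ Icc 0 (τ k), ζ k t = ζ k 0 + ∫ r in (0 : ℝ)..t, f (ζ k r) (a k))
    {t : ℝ} (ht : t ∈ timeInterval (totalTime τ)) :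
    IntervalIntegrable (fun s => f (z s) (α s)) volume 0 t ∧
      z t = z 0 + ∫ s in (0 : ℝ)..t, f (z s) (α s) := by
  have hmono := switchTime_strictMono hτ
  have hpiece : ∀ k, ∀ t ∈ Icc (switchTime τ k) (switchTime τ (k + 1)),
      IntervalIntegrable (fun s => f (z s) (α s)) volume (switchTime τ k) t ∧
      z t = z (switchTime τ k) + ∫ s in (switchTime τ k)..t, f (z s) (α s) := by
    intro k t ht
    have heq : ∀ s ∈ uIoc (switchTime τ k) t,
        f (ζ k (s - switchTime τ k)) (a k) = f (z s) (α s) := by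
      intro s hs
      rw [uIoc_of_le ht.1] at hs
      have hs' : s ∈ Ioc (switchTime τ k) (switchTime τ (k + 1)) := ⟨hs.1, hs.2.trans ht.2⟩
      rw [hα k s hs', hz k s (Ioc_subset_Icc_self hs')]
    have ht' : t - switchTime τ k ∈ Icc 0 (τ k) := by
      have := ht.2
      rw [switchTime_succ] at this
      exact ⟨by linarith [ht.1], by linarith⟩
    constructor
    · have := (hint k _ ht').comp_sub_right (switchTime τ k)
      rw [zero_add, sub_add_cancel] at this
      exact this.congr heq
    · have h1 : ∫ s in (switchTime τ k)..t, f (z s) (α s) =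
          ∫ s in (switchTime τ k)..t, f (ζ k (s - switchTime τ k)) (a k) :=
        intervalIntegral.integral_congr_ae (Eventually.of_forall fun s hs => (heq s hs).symm)
      rw [h1, intervalIntegral.integral_comp_sub_right (fun r => f (ζ k r) (a k)), sub_self,
        hz k t ht, hz k _ ⟨le_rfl, (hmono k.lt_succ_self).le⟩, sub_self]
      exact hsol k _ ht'
  have hall : ∀ k, IntervalIntegrable (fun s => f (z s) (α s)) volume 0 (switchTime τ k) ∧
      z (switchTime τ k) = z 0 + ∫ s in (0 : ℝ)..switchTime τ k, f (z s) (α s) := by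
    intro k
    induction k with
    | zero => rw [switchTime_zero]; simp
    | succ k ih =>
      obtain ⟨h1, h2⟩ := hpiece k _ ⟨(hmono k.lt_succ_self).le, le_rfl⟩
      refine ⟨ih.1.trans h1, ?_⟩
      rw [h2, ih.2, ← intervalIntegral.integral_add_adjacent_intervals ih.1 h1, add_assoc]
  obtain ⟨k, hk⟩ := exists_mem_Icc_switchTime ht
  obtain ⟨h1, h2⟩ := hpiece k t hk
  refine ⟨(hall k).1.trans h1, ?_⟩
  rw [h2, (hall k).2, ← intervalIntegral.integral_add_adjacent_intervals (hall k).1 h1, add_assoc]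

/-- Only an upper bound is needed, so countable subadditivity over closed pieces suffices and their
common endpoints do no harm. -/
theorem cost_le_tsum_of_pieces (hτ : ∀ k, 0 < τ k) {a : ℕ → E m}
    {ζ : ℕ → ℝ → E n} {z : ℝ → E n} {α : ℝ → E m}
    (hα : ∀ k, ∀ t ∈ Ioc (switchTime τ k) (switchTime τ (k + 1)), α t = a k)
    (hz : ∀ k, ∀ t ∈ Icc (switchTime τ k) (switchTime τ (k + 1)),
      z t = ζ k (t - switchTime τ k))
    (hint : ∀ k, IntervalIntegrable (fun r => l (ζ k r) (a k)) volume 0 (τ k))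
    (hl : ∀ k, ∀ t ∈ Icc 0 (τ k), 0 ≤ l (ζ k t) (a k)) :
    cost l (totalTime τ) z α ≤ ∑' k, ENNReal.ofReal (∫ r in (0 : ℝ)..τ k, l (ζ k r) (a k)) := by
  have hsub : timeInterval (totalTime τ) ⊆
      ⋃ k, Icc (switchTime τ k) (switchTime τ (k + 1)) := fun t ht =>
    mem_iUnion.2 (exists_mem_Icc_switchTime ht)
  refine (lintegral_mono_set hsub).trans ((lintegral_iUnion_le _ _).trans
    (ENNReal.tsum_le_tsum fun k => le_of_eq ?_))
  have hle : switchTime τ k ≤ switchTime τ (k + 1) :=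
    (switchTime_strictMono hτ k.lt_succ_self).le
  rw [← setLIntegral_congr Ioc_ae_eq_Icc, setLIntegral_congr_fun measurableSet_Ioc
    (g := fun s => ENNReal.ofReal (l (ζ k (s - switchTime τ k)) (a k)))
    (fun t ht => by simp only [hα k t ht, hz k t (Ioc_subset_Icc_self ht)])]
  have hint' : IntervalIntegrable (fun s => l (ζ k (s - switchTime τ k)) (a k)) volume
      (switchTime τ k) (switchTime τ (k + 1)) := by
    have := (hint k).comp_sub_right (switchTime τ k)
    rwa [zero_add, add_comm, ← switchTime_succ] at this
  rw [← ofReal_integral_eq_lintegral_ofReal ((intervalIntegrable_iff_integrableOn_Ioc_of_le hle).1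
    hint'), ← intervalIntegral.integral_of_le hle,
    intervalIntegral.integral_comp_sub_right (fun r => l (ζ k r) (a k)), sub_self, switchTime_succ,
    add_sub_cancel_left]
  refine (ae_restrict_iff' measurableSet_Ioc).2 (Eventually.of_forall fun s hs => hl k _ ?_)
  have := hs.2
  rw [switchTime_succ] at this
  exact ⟨by linarith [hs.1], by linarith⟩

end Concatenation

/-! ### Global trajectories, controllability and the cost bound -/

section Main

variable {n m : ℕ} {C : Set (E n)} {A : Set (E m)} {f : E n → E m → E n} {l : E n → E m → ℝ}
  {U : E n → ℝ} {p₀ : ℝ}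

theorem continuousOn_comp_of_control {V : Type*} [TopologicalSpace V] {g : E n → E m → V}
    (hg : ContinuousOn (fun q : E n × E m => g q.1 q.2) (Cᶜ ×ˢ A)) {a : E m} (ha : a ∈ A)
    {z : ℝ → E n} (hz : Continuous z) {s : ℝ} (hzC : ∀ t ∈ Icc 0 s, z t ∈ Cᶜ) :
    ContinuousOn (fun t => g (z t) a) (Icc 0 s) :=
  hg.comp (f := fun t => (z t, a)) (by fun_prop) fun t ht => ⟨hzC t ht, ha⟩

/-- Concatenating descent steps yields an admissible pair along which `U` decreases to zero, with a
rate controlled by the step lengths, and whose cost is controlled by `U`. -/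
theorem exists_descent_trajectory
    (hlf : ContinuousOn (fun q : E n × E m => (l q.1 q.2, f q.1 q.2)) (Cᶜ ×ˢ A))
    (hl : ∀ x ∈ Cᶜ, ∀ a ∈ A, 0 ≤ l x a) (hU : IsMRFWith C A f l U p₀) {σ : E n → ℝ}
    (hσ : ∀ x ∈ Cᶜ, HasDescentStep C A f l U p₀ x (σ x))
    (hσK : ∀ K ⊆ Cᶜ, IsCompact K → ∃ s > 0, ∀ x ∈ K, s ≤ σ x) {x : E n} (hx : x ∈ Cᶜ)
    (zbar : E n) :
    ∃ (T : EReal) (z : ℝ → E n) (α : ℝ → E m), IsAdmissible C A f x T z α ∧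
      (∀ t : ℝ, T ≤ (t : EReal) → z t = zbar) ∧
      (∀ t ∈ timeInterval T, U (z t) ≤ U x) ∧
      (∀ a b s : ℝ, 0 < a → 0 < s → U x ≤ b → (∀ y ∈ Cᶜ ∩ U ⁻¹' Icc a b, s ≤ σ y) →
        ∀ t ∈ timeInterval T, b / s + 1 < t → U (z t) < a) ∧
      (0 < p₀ → cost l T z α ≤ ENNReal.ofReal (U x / p₀)) := by
  choose! hσ0 hσ1 ctrl hctrl ζ hζc hζ0 hζ using hσ
  set X : ℕ → E n := fun k => (fun y => ζ y (σ y))^[k] x with hX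
  have hXsucc : ∀ k, X (k + 1) = ζ (X k) (σ (X k)) := fun k => Function.iterate_succ_apply' _ _ _
  have hXC : ∀ k, X k ∈ Cᶜ := by
    intro k
    induction k with
    | zero => exact hx
    | succ k ih =>
      rw [hXsucc]
      exact (hζ (X k) ih _ ⟨(hσ0 _ ih).le, le_rfl⟩).1
  set τ : ℕ → ℝ := fun k => σ (X k) with hτdef
  have hτ : ∀ k, 0 < τ k := fun k => hσ0 _ (hXC k)
  have hmono := switchTime_strictMono hτ
  have hlin : ∀ k, ∀ t ∈ Icc 0 (τ k),
      IntervalIntegrable (fun r => l (ζ (X k) r) (ctrl (X k))) volume 0 t := fun k t ht =>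
    ((continuousOn_comp_of_control hlf.fst (hctrl _ (hXC k)) (hζc _ (hXC k))
      fun t ht => (hζ _ (hXC k) t ht).1).mono (by
        rw [uIcc_of_le ht.1]; exact Icc_subset_Icc_right ht.2)).intervalIntegrable
  have hfin : ∀ k, ∀ t ∈ Icc 0 (τ k),
      IntervalIntegrable (fun r => f (ζ (X k) r) (ctrl (X k))) volume 0 t := fun k t ht =>
    ((continuousOn_comp_of_control hlf.snd (hctrl _ (hXC k)) (hζc _ (hXC k))
      fun t ht => (hζ _ (hXC k) t ht).1).mono (by
        rw [uIcc_of_le ht.1]; exact Icc_subset_Icc_right ht.2)).intervalIntegrable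
  have hlnn : ∀ k, ∀ t ∈ Icc 0 (τ k), 0 ≤ ∫ r in (0 : ℝ)..t, l (ζ (X k) r) (ctrl (X k)) :=
    fun k t ht => intervalIntegral.integral_nonneg ht.1 fun r hr =>
      hl _ (hζ _ (hXC k) r ⟨hr.1, hr.2.trans ht.2⟩).1 _ (hctrl _ (hXC k))
  obtain ⟨z, α, hαm, hα0, hzbar, hα, hz⟩ := exists_concatenation hτ (fun k => ctrl (X k))
    (fun k => ζ (X k)) (fun k => by rw [hζ0 _ (hXC _), hXsucc]) zbar
  have hz0 : z 0 = x := by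
    have := hz 0 0 ⟨switchTime_zero.le, switchTime_nonneg hτ _⟩
    rw [this, switchTime_zero, sub_self, hζ0 _ (hXC 0)]
    rfl
  have hshift : ∀ k, ∀ t ∈ Icc (switchTime τ k) (switchTime τ (k + 1)),
      t - switchTime τ k ∈ Icc 0 (τ k) := fun k t ht => by
    have := ht.2
    rw [switchTime_succ] at this
    exact ⟨by linarith [ht.1], by linarith⟩
  have hUz : ∀ k, ∀ t ∈ Icc (switchTime τ k) (switchTime τ (k + 1)), U (z t) ≤ U (X k) := by
    intro k t ht
    have ht' := hshift k t ht
    have h1 := (hζ _ (hXC k) _ ht').2.2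
    have h2 := mul_nonneg hU.nonneg (hlnn k _ ht')
    have h3 := mul_nonneg (hτ k).le ht'.1
    rw [hz k t ht]
    linarith
  have hstep : ∀ k, U (X (k + 1)) +
      p₀ * (∫ r in (0 : ℝ)..τ k, l (ζ (X k) r) (ctrl (X k))) ≤ U (X k) - τ k * τ k := fun k => by
    rw [hXsucc]
    exact (hζ _ (hXC k) _ ⟨(hτ k).le, le_rfl⟩).2.2
  have hstep' : ∀ k, U (X (k + 1)) ≤ U (X k) - τ k * τ k := fun k => by
    linarith [hstep k, mul_nonneg hU.nonneg (hlnn k _ ⟨(hτ k).le, le_rfl⟩)]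
  have hXanti : Antitone fun k => U (X k) := antitone_nat_of_succ_le fun k => by
    linarith [hstep' k, mul_self_nonneg (τ k)]
  -- A step of length `τ k` lowers `U` by at least `τ k * τ k`, hence at rate at least `s` per unit
  -- time while the nodes remain in the band; by monotonicity, a node above `a` puts all earlier
  -- ones there too.
  have hdecr : ∀ a b s : ℝ, 0 < s → U x ≤ b → (∀ y ∈ Cᶜ ∩ U ⁻¹' Icc a b, s ≤ σ y) →
      ∀ k, a ≤ U (X k) → U (X k) ≤ U x - s * switchTime τ k := by
    intro a b s hs hb hsσ k
    induction k with
    | zero => intro _; rw [switchTime_zero]; simp [hX]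
    | succ k ih =>
      intro hk
      have hk' : a ≤ U (X k) := hk.trans (hXanti k.le_succ)
      have h1 := hsσ (X k) ⟨hXC k, hk', (hXanti k.zero_le).trans hb⟩
      have h2 : s * τ k ≤ τ k * τ k := mul_le_mul_of_nonneg_right h1 (hτ k).le
      rw [switchTime_succ, mul_add]
      linarith [ih hk', hstep' k]
  have hXpos : ∀ k, 0 < U (X k) := fun k => hU.posDefOn.1 _ (hXC k)
  -- If `U` stayed above `a`, every step would have length at least a fixed `s` and cost `U` at
  -- least `s * s`, against positivity of `U`.
  have hXlim : ∀ a > 0, ∃ k, U (X k) < a := by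
    intro a ha
    by_contra hcon
    push Not at hcon
    obtain ⟨s, hs, hsσ⟩ := hσK _ inter_subset_left (hU.isCompact_level ha (U x))
    have hkt : ∀ k : ℕ, k * s ≤ switchTime τ k := by
      intro k
      induction k with
      | zero => rw [switchTime_zero]; simp
      | succ k ih =>
        have : s ≤ τ k := hsσ (X k) ⟨hXC k, hcon k, hXanti k.zero_le⟩
        rw [switchTime_succ]
        push_cast
        linarith
    obtain ⟨k, hk⟩ := exists_nat_gt (U x / (s * s))
    rw [div_lt_iff₀ (by positivity)] at hk
    have h1 := hdecr a (U x) s hs le_rfl hsσ k (hcon k)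
    have h2 := mul_le_mul_of_nonneg_left (hkt k) hs.le
    have h3 := hXpos k
    linarith
  have hmem : ∀ t ∈ timeInterval (totalTime τ), z t ∈ Cᶜ := fun t ht => by
    obtain ⟨k, hk⟩ := exists_mem_Icc_switchTime ht
    rw [hz k t hk]
    exact (hζ _ (hXC k) _ (hshift k t hk)).1
  have hsolution : ∀ t ∈ timeInterval (totalTime τ),
      IntervalIntegrable (fun s => f (z s) (α s)) volume 0 t ∧
      z t = z 0 + ∫ s in (0 : ℝ)..t, f (z s) (α s) := fun t ht =>
    solution_of_pieces hτ hα hz hfin (fun k t ht => by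
      rw [hζ0 _ (hXC k)]
      exact (hζ _ (hXC k) t ht).2.1) ht
  refine ⟨totalTime τ, z, α, ⟨?_, hαm, fun t ht => ?_, hmem, fun t ht => (hsolution t ht).1,
    fun t ht => hz0 ▸ (hsolution t ht).2, ?_⟩, hzbar, fun t ht => ?_, ?_, fun hp₀ => ?_⟩
  · have := switchTime_lt_totalTime hτ 0
    rwa [switchTime_zero] at this
  · obtain ⟨k, hk⟩ := exists_mem_Icc_switchTime ht
    rcases ht.1.eq_or_lt with h | h
    · rw [← h, hα0]
      exact hctrl _ (hXC 0)
    · rcases hk.1.eq_or_lt with h' | h'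
      · cases k with
        | zero => rw [switchTime_zero] at h'; exact absurd h' h.ne
        | succ k =>
          rw [hα k t ⟨h' ▸ hmono k.lt_succ_self, h'.ge⟩]
          exact hctrl _ (hXC k)
      · rw [hα k t ⟨h', hk.2⟩]
        exact hctrl _ (hXC k)
  · rw [Metric.tendsto_nhds]
    intro ε hε
    obtain ⟨η, hη, hηε⟩ := hU.exists_lt_imp_infDist_lt hε
    obtain ⟨k, hk⟩ := hXlim η hη
    -- Left neighbourhoods in `EReal` treat finite and infinite total times alike.
    refine mem_comap.2 ⟨Ioo (switchTime τ k : EReal) (totalTime τ),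
      Ioo_mem_nhdsLT (switchTime_lt_totalTime hτ k), fun t ht => ?_⟩
    have htk : switchTime τ k < t := EReal.coe_lt_coe_iff.1 ht.1
    have htT : t ∈ timeInterval (totalTime τ) :=
      ⟨(switchTime_nonneg hτ k).trans htk.le, ht.2⟩
    obtain ⟨j, hj⟩ := exists_mem_Icc_switchTime htT
    have hkj : k ≤ j := by
      have := hmono.lt_iff_lt.1 (htk.trans_le hj.2)
      omega
    show dist _ _ < ε
    rw [Real.dist_0_eq_abs, abs_of_nonneg Metric.infDist_nonneg]
    exact hηε _ (hmem t htT) (((hUz j t hj).trans (hXanti hkj)).trans_lt hk)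
  · obtain ⟨k, hk⟩ := exists_mem_Icc_switchTime ht
    exact (hUz k t hk).trans (hXanti k.zero_le)
  · intro a b s ha hs hb hsσ t ht hbt
    obtain ⟨k, hk⟩ := exists_mem_Icc_switchTime ht
    by_contra hcon
    have h1 : a ≤ U (X k) := (not_lt.1 hcon).trans (hUz k t hk)
    have h2 := hdecr a b s hs hb hsσ k h1
    -- Steps last at most `1`, so the node preceding `t` comes after `b / s`; this is the extra `1`
    -- in the waiting time.
    have h3 : b / s < switchTime τ k := by
      have h4 := hk.2
      rw [switchTime_succ] at h4
      linarith [hσ1 _ (hXC k)]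
    rw [div_lt_iff₀ hs] at h3
    linarith [hXpos k]
  · refine (cost_le_tsum_of_pieces hτ hα hz (fun k => hlin k _ ⟨(hτ k).le, le_rfl⟩)
      fun k t ht => hl _ (hζ _ (hXC k) t ht).1 _ (hctrl _ (hXC k))).trans
      (ENNReal.tsum_le_of_sum_range_le fun N => ?_)
    rw [← ENNReal.ofReal_sum_of_nonneg fun k _ => hlnn k _ ⟨(hτ k).le, le_rfl⟩]
    refine ENNReal.ofReal_le_ofReal ?_
    rw [le_div_iff₀ hp₀, mul_comm, Finset.mul_sum]
    have : ∀ N, ∑ k ∈ Finset.range N,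
        p₀ * (∫ r in (0 : ℝ)..τ k, l (ζ (X k) r) (ctrl (X k))) ≤ U x - U (X N) := by
      intro N
      induction N with
      | zero => simp [hX]
      | succ N ih =>
        rw [Finset.sum_range_succ]
        linarith [hstep N, mul_self_nonneg (τ N)]
    linarith [this N, hXpos N]

/-- With an empty target, properness would give `U` a positive global minimum, and a descent step
from the minimum point would go below it. -/
theorem IsMRFWith.target_nonempty (hl : ∀ x ∈ Cᶜ, ∀ a ∈ A, 0 ≤ l x a)
    (hU : IsMRFWith C A f l U p₀) {σ : E n → ℝ}
    (hσ : ∀ x ∈ Cᶜ, HasDescentStep C A f l U p₀ x (σ x)) : C.Nonempty := by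
  rw [nonempty_iff_ne_empty]
  intro hC
  have hmem : ∀ x : E n, x ∈ Cᶜ := fun x => by simp [hC]
  have hpos : ∀ x, 0 < U x := fun x => hU.posDefOn.1 x (hmem x)
  obtain ⟨y, hy, hmin⟩ := (hU.properOn (Icc 0 (U 0)) (fun u hu => hu.1) isCompact_Icc).exists_isMinOn
    ⟨0, subset_closure (hmem 0), (hpos 0).le, le_rfl⟩ (hU.continuousOn.mono inter_subset_left)
  obtain ⟨hs, -, a, ha, z, -, -, hz⟩ := hσ y (hmem y)
  obtain ⟨-, -, hdec⟩ := hz _ ⟨hs.le, le_rfl⟩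
  have hcost : 0 ≤ ∫ r in (0 : ℝ)..σ y, l (z r) a :=
    intervalIntegral.integral_nonneg hs.le fun r _ => hl _ (hmem _) _ ha
  have hlt : U (z (σ y)) < U y := by
    linarith [mul_nonneg hU.nonneg hcost, mul_pos hs hs]
  have := isMinOn_iff.1 hmin (z (σ y))
    ⟨subset_closure (hmem _), (hpos _).le, hlt.le.trans hy.2.2⟩
  linarith

theorem IsMRFWith.isGAC (hn : 0 < n) (hC : IsClosed C) (hCb : IsCompact (frontier C))
    (hA : IsCompact A)
    (hlf : ContinuousOn (fun q : E n × E m => (l q.1 q.2, f q.1 q.2)) (Cᶜ ×ˢ A))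
    (hl : ∀ x ∈ Cᶜ, ∀ a ∈ A, 0 ≤ l x a) (hU : IsMRFWith C A f l U p₀) : IsGAC C A f := by
  obtain ⟨σ, hσ, hσK⟩ := exists_stepLength hn hC hA hlf hU
  have hne := hU.target_nonempty hl hσ
  have hfr : ∀ x : E n, x ∈ Cᶜ → ∃ zbar, zbar ∈ frontier C := fun x hx => by
    obtain ⟨w, hw, -⟩ := exists_mem_frontier_dist_le hx hne.choose_spec
    exact ⟨w, hw⟩
  choose! zbar hzbar using hfr
  -- One trajectory is fixed for every initial point; the comparison function is built for this
  -- family, indexed by `Cᶜ`.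
  have htraj := fun i : ↥Cᶜ => exists_descent_trajectory hlf hl hU hσ hσK i.2 (zbar i)
  choose T z α hadm hend hle hrate _ using htraj
  have hend0 : ∀ i : ↥Cᶜ, ∀ t : ℝ, T i ≤ (t : EReal) → Metric.infDist (z i t) C = 0 :=
    fun i t ht => by
      rw [hend i t ht]
      exact Metric.infDist_zero_of_mem (hC.frontier_subset (hzbar i i.2))
  suffices h : ∃ β : ℝ → ℝ → ℝ, IsKL β ∧ ∀ (i : ↥Cᶜ) (t : ℝ), 0 ≤ t →
      Metric.infDist (z i t) C ≤ β (Metric.infDist (i : E n) C) t by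
    obtain ⟨β, hβ, hbound⟩ := h
    exact ⟨β, hβ, fun x hx => ⟨T ⟨x, hx⟩, z ⟨x, hx⟩, α ⟨x, hx⟩, hadm ⟨x, hx⟩,
      ⟨zbar x, hzbar x hx, hend ⟨x, hx⟩⟩, fun t ht => hbound ⟨x, hx⟩ t ht⟩⟩
  refine exists_isKL (s := fun i : ↥Cᶜ => Metric.infDist (i : E n) C)
    (D := fun i t => Metric.infDist (z i t) C) (fun i => infDist_pos hC hne i.2)
    (fun _ _ _ => Metric.infDist_nonneg) ?_ ?_ ?_
  · intro r
    obtain ⟨b, hb⟩ := hU.exists_le_of_infDist_le hC hCb hne r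
    obtain ⟨M, hM⟩ := hU.exists_infDist_le_of_le b
    refine ⟨max M 0, fun i hi t ht => ?_⟩
    by_cases h : T i ≤ (t : EReal)
    · rw [hend0 i t h]
      exact le_max_right _ _
    · have htT : t ∈ timeInterval (T i) := ⟨ht, not_le.1 h⟩
      exact (hM _ ((hadm i).state_mem t htT) ((hle i t htT).trans (hb i i.2 hi))).trans
        (le_max_left _ _)
  · intro ε hε
    obtain ⟨η, hη, hηε⟩ := hU.exists_lt_imp_infDist_lt hε
    obtain ⟨r, hr, hrη⟩ := hU.exists_infDist_le_imp_lt hC hCb hne hη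
    refine ⟨r, hr, fun i hi t ht => ?_⟩
    by_cases h : T i ≤ (t : EReal)
    · rw [hend0 i t h]
      exact hε.le
    · have htT : t ∈ timeInterval (T i) := ⟨ht, not_le.1 h⟩
      exact (hηε _ ((hadm i).state_mem t htT) ((hle i t htT).trans_lt (hrη i i.2 hi))).le
  · intro r ε hε
    obtain ⟨η, hη, hηε⟩ := hU.exists_lt_imp_infDist_lt hε
    obtain ⟨b, hb⟩ := hU.exists_le_of_infDist_le hC hCb hne r
    obtain ⟨s, hs, hsσ⟩ := hσK _ inter_subset_left (hU.isCompact_level hη b)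
    -- The decay estimate needs `t` strictly beyond `b / s + 1`.
    refine ⟨b / s + 2, fun i hi t ht hTt => ?_⟩
    by_cases h : T i ≤ (t : EReal)
    · rw [hend0 i t h]
      exact hε.le
    · have htT : t ∈ timeInterval (T i) := ⟨ht, not_le.1 h⟩
      exact (hηε _ ((hadm i).state_mem t htT)
        (hrate i η b s hη hs (hb i i.2 hi) hsσ t htT (by linarith))).le

end Main

end MinimumRestraint

theorem theorem1p1 {n m : ℕ} (hn : 0 < n)
    (C : Set (EuclideanSpace ℝ (Fin n))) (hC : IsClosed C) (hCb : IsCompact (frontier C))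
    (A : Set (EuclideanSpace ℝ (Fin m))) (hA : IsCompact A)
    (f : EuclideanSpace ℝ (Fin n) → EuclideanSpace ℝ (Fin m) → EuclideanSpace ℝ (Fin n))
    (l : EuclideanSpace ℝ (Fin n) → EuclideanSpace ℝ (Fin m) → ℝ)
    (hlf : ContinuousOn
      (fun q : EuclideanSpace ℝ (Fin n) × EuclideanSpace ℝ (Fin m) => (l q.1 q.2, f q.1 q.2))
      (Cᶜ ×ˢ A))
    (hl : ∀ x ∈ Cᶜ, ∀ a ∈ A, 0 ≤ l x a) :
    ((∃ U : EuclideanSpace ℝ (Fin n) → ℝ, MinimumRestraint.IsMRF C A f l U) →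
      MinimumRestraint.IsGAC C A f) ∧
    (∀ (U : EuclideanSpace ℝ (Fin n) → ℝ) (p₀ : ℝ),
      MinimumRestraint.IsMRFWith C A f l U p₀ → 0 < p₀ →
      ∀ x ∈ Cᶜ, MinimumRestraint.valueFunction C A f l x ≤ ENNReal.ofReal (U x / p₀)) := by
  refine ⟨?_, fun U p₀ hU hp₀ x hx => ?_⟩
  · rintro ⟨U, p₀, hU⟩
    exact hU.isGAC hn hC hCb hA hlf hl
  · obtain ⟨σ, hσ, hσK⟩ := MinimumRestraint.exists_stepLength hn hC hA hlf hU
    -- The prolongation value `0` is arbitrary: the cost and admissibility see only times before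
    -- `T`.
    obtain ⟨T, z, α, hadm, -, -, -, hcost⟩ :=
      MinimumRestraint.exists_descent_trajectory hlf hl hU hσ hσK hx 0
    refine le_trans ?_ (hcost hp₀)
    exact sInf_le ⟨T, z, α, hadm, rfl⟩
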